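/- Let $n,m$ be natural numbers and write $M_n=M_n(\mathbb C)$. **Definitions.** For a unitary $U=(U_{ij})\in M_n(\mathcal B(\mathcal H))$, $\mathcal H$ a Hilbert space, put $\mathfrak B_n(U)=\{I_{\mathcal H}\}\cup\{U_{ij},U_{ij}^*\}_{i,j=1}^n$. Let $\mathcal U_{nc}(n)$ be the universal unital $C^*$-algebra generated by elements $u_{ij}$, $1\le i,j\le n$, such that the matrix $(u_{ij})$ is unitary, and let $\mathcal V_n=\mathrm{span}\{1,u_{ij},u_{ij}^*\}_{i,j=1}^n\subseteq\mathcal U_{nc}(n)$, an operator system; $v_{k\ell}$ denotes the generators of $\mathcal U_{nc}(m)$. For operator systems $\mathcal S,\mathcal T$, an element $X$ of $\mathcal S\otimes\mathcal T$ is positive in $\mathcal S\otimes_{\min}\mathcal T$ iff $(\varphi\otimes\psi)(X)\ge 0$ in $M_{pq}$ for all $p,q$ and all unital completely positive maps $\varphi:\mathcal S\to M_p$, $\psi:\mathcal T\to M_q$; it is positive in $\mathcal S\otimes_{\max}\mathcal T$ iff for every $\varepsilon>0$ there are $p,q$, $P\in M_p(\mathcal S)_+$, $Q\in M_q(\mathcal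 T)_+$ and a linear map $A:\mathbb C\to\mathbb C^p\otimes\mathbb C^q$ with $X+\varepsilon(1\otimes 1)=A^*(P\otimes Q)A$. A state on such a tensor product is a unital positive linear functional. Identify a family $(x_{(i,j),(k,\ell)})$ with $\sum x_{(i,j),(k,\ell)}E_{ij}\otimes E_{k\ell}\in M_n\otimes M_m$. Define the following subsets of $M_n\otimes M_m$: * $B_{qc}(n,m)$: all $(\langle U_{ij}V_{k\ell}\psi,\psi\rangle)_{(i,j),(k,\ell)}$, where $\mathcal H$ is a Hilbert space, $\psi\in\mathcal H$ is a unit vector, $U\in M_n(\mathcal B(\mathcal H))$ and $V\in M_m(\mathcal B(\mathcal H))$ are unitary, and $XY=YX$ for all $X\in\mathfrak B_n(U)$, $Y\in\mathfrak B_m(V)$; * $B_{loc}(n,m)$: those elements of $B_{qc}(n,m)$ that arise from $U,V$ for which the $C^*$-algebra generated by $\mathfrak B_n(U)\cup\mathfrak B_m(V)$ is commutative; * $B_{qa}(n,m)$: all $(s(u_{ij}\otimes v_{k\ell}))_{(i,j),(k,\ell)}$ with $s$ a state on $\mathcal V_n\otimes_{\min}\mathcal V_m$; * $B_{qmax}(n,m)$: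 all $(s(u_{ij}\otimes v_{k\ell}))_{(i,j),(k,\ell)}$ with $s$ a state on $\mathcal V_n\otimes_{\max}\mathcal V_m$. **Theorem.** For each $t\in\{loc,qa,qc,qmax\}$, the set $B_t(n,m)$ is the closed unit ball of a norm $\|\cdot\|_t$ on the complex vector space $M_n\otimes M_m$. Moreover, $\|\cdot\|_{loc}$ is the projective Banach space tensor norm of $M_n\otimes_\pi M_m$: $$\|X\|_{loc}=\inf\Big\{\sum_{i=1}^d\|x_i\|\,\|y_i\| : d\in\mathbb N,\ x_i\in M_n,\ y_i\in M_m,\ X=\sum_{i=1}^d x_i\otimes y_i\Big\}\qquad(X\in M_n\otimes M_m),$$ where $M_n$ and $M_m$ carry the operator norm. -/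

import Mathlib

universe u

noncomputable section

open scoped TensorProduct ComplexConjugate ComplexOrder

namespace BrownAlgebra

/-- Letters: `(i, j, false)` is the generator `u i j`, `(i, j, true)` is its formal adjoint. -/
abbrev Letter (n : ℕ) : Type := Fin n × Fin n × Bool

/-- Exchange a generator and its formal adjoint. -/
def flip {n : ℕ} (x : Letter n) : Letter n := (x.1, x.2.1, !x.2.2)

/-- The formal adjoint of a word: reverse it and take the adjoint of every letter. -/
def wordStar {n : ℕ} (w : FreeMonoid (Letter n)) : FreeMonoid (Letter n) :=
  FreeMonoid.map flip w.reverse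

/-- The free unital `*`-algebra over `ℂ` on generators `u i j`, `i, j < n`: noncommutative
polynomials in the `u i j` and their formal adjoints. -/
def StarPoly (n : ℕ) : Type := MonoidAlgebra ℂ (FreeMonoid (Letter n))

variable {n : ℕ}

instance : Ring (StarPoly n) := inferInstanceAs (Ring (MonoidAlgebra ℂ (FreeMonoid (Letter n))))

instance : Algebra ℂ (StarPoly n) :=
  inferInstanceAs (Algebra ℂ (MonoidAlgebra ℂ (FreeMonoid (Letter n))))

/-- The monomial `c • w`. -/
def mono (w : FreeMonoid (Letter n)) (c : ℂ) : StarPoly n :=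
  (MonoidAlgebra.single w c : MonoidAlgebra ℂ (FreeMonoid (Letter n)))

theorem mono_mul_mono (w v : FreeMonoid (Letter n)) (c d : ℂ) :
    mono w c * mono v d = mono (w * v) (c * d) :=
  MonoidAlgebra.single_mul_single _ _ _ _

theorem one_eq_mono : (1 : StarPoly n) = mono 1 1 := MonoidAlgebra.one_def

theorem smul_mono (c d : ℂ) (w : FreeMonoid (Letter n)) : c • mono w d = mono w (c * d) :=
  MonoidAlgebra.smul_single c w d

theorem mono_add (w : FreeMonoid (Letter n)) (c d : ℂ) : mono w (c + d) = mono w c + mono w d :=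
  MonoidAlgebra.single_add w c d

theorem mono_zero (w : FreeMonoid (Letter n)) : mono w 0 = 0 :=
  MonoidAlgebra.single_zero w

theorem poly_induction {motive : StarPoly n → Prop} (x : StarPoly n) (zero : motive 0)
    (add : ∀ x y, motive x → motive y → motive (x + y)) (mono : ∀ w c, motive (mono w c)) :
    motive x :=
  MonoidAlgebra.induction_linear (motive := motive) x zero add mono

/-- The involution of the free `*`-algebra: conjugate-linear, and `w ↦ wordStar w` on words. -/
def polyStar (x : StarPoly n) : StarPoly n :=
  Finsupp.sum (MonoidAlgebra.coeff x) fun w c => mono (wordStar w) (conj c)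

theorem polyStar_mono (w : FreeMonoid (Letter n)) (c : ℂ) :
    polyStar (mono w c) = mono (wordStar w) (conj c) := by
  unfold polyStar
  exact Finsupp.sum_single_index (by simp [mono_zero])

theorem polyStar_add (x y : StarPoly n) : polyStar (x + y) = polyStar x + polyStar y := by
  unfold polyStar
  refine Finsupp.sum_add_index' (fun w => by simp [mono_zero]) (fun w c d => ?_)
  rw [map_add, mono_add]

theorem polyStar_zero : polyStar (0 : StarPoly n) = 0 := by
  simpa using polyStar_add (0 : StarPoly n) 0

theorem wordStar_mul (w v : FreeMonoid (Letter n)) :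
    wordStar (w * v) = wordStar v * wordStar w := by
  simp [wordStar, FreeMonoid.reverse_mul]

theorem wordStar_of (x : Letter n) : wordStar (FreeMonoid.of x) = FreeMonoid.of (flip x) := by
  simp [wordStar]

theorem wordStar_one : wordStar (1 : FreeMonoid (Letter n)) = 1 := rfl

theorem wordStar_wordStar (w : FreeMonoid (Letter n)) : wordStar (wordStar w) = w := by
  induction w using FreeMonoid.recOn with
  | one => rfl
  | of_mul x xs h => rw [wordStar_mul, wordStar_mul, wordStar_of, wordStar_of, h]; simp [flip]

instance : StarRing (StarPoly n) where
  star := polyStar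
  star_involutive x := by
    induction x using poly_induction with
    | zero => simp [polyStar_zero]
    | add x y hx hy => rw [polyStar_add, polyStar_add, hx, hy]
    | mono w c => rw [polyStar_mono, polyStar_mono, wordStar_wordStar, Complex.conj_conj]
  star_mul x y := by
    induction x using poly_induction with
    | zero => simp [polyStar_zero]
    | add x x' hx hx' => rw [add_mul, polyStar_add, hx, hx', polyStar_add, mul_add]
    | mono w c =>
      induction y using poly_induction with
      | zero => simp [polyStar_zero]
      | add y y' hy hy' => rw [mul_add, polyStar_add, hy, hy', polyStar_add, add_mul]
      | mono v d =>
        rw [mono_mul_mono, polyStar_mono, polyStar_mono, polyStar_mono, mono_mul_mono,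
          wordStar_mul, map_mul, mul_comm (conj c)]
  star_add := polyStar_add

theorem star_mono (w : FreeMonoid (Letter n)) (c : ℂ) :
    star (mono w c) = mono (wordStar w) (conj c) := polyStar_mono w c

instance : StarModule ℂ (StarPoly n) where
  star_smul c x := by
    induction x using poly_induction with
    | zero => simp
    | add x y hx hy => rw [smul_add, star_add, hx, hy, star_add, smul_add]
    | mono w d =>
      rw [smul_mono, star_mono, star_mono, smul_mono, map_mul, starRingEnd_apply]

/-- The generator `u i j` of the free `*`-algebra. -/
def polyGen (i j : Fin n) : StarPoly n := mono (FreeMonoid.of (i, j, false)) 1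

theorem star_polyGen (i j : Fin n) :
    star (polyGen i j) = mono (FreeMonoid.of (i, j, true)) 1 := by
  simp [polyGen, star_mono, wordStar_of, flip]

/-- The matrix `(u i j)` over the free `*`-algebra. -/
def polyMatrix (n : ℕ) : Matrix (Fin n) (Fin n) (StarPoly n) := Matrix.of polyGen

/-- `p` is a C⋆-seminorm on the free `*`-algebra for which the relations `U⋆U = 1 = UU⋆` hold.
(The condition `gen_le` follows from the others; see `norm_entry_le` for C⋆-algebras.) -/
structure IsUnitarySeminorm (p : Seminorm ℂ (StarPoly n)) : Prop where
  one_le : p 1 ≤ 1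
  mul_le : ∀ x y, p (x * y) ≤ p x * p y
  star_mul_self : ∀ x, p (star x * x) = p x * p x
  gen_le : ∀ i j, p (polyGen i j) ≤ 1
  rel_left : ∀ i j, p ((star (polyMatrix n) * polyMatrix n - 1) i j) = 0
  rel_right : ∀ i j, p ((polyMatrix n * star (polyMatrix n) - 1) i j) = 0

namespace IsUnitarySeminorm

variable {p : Seminorm ℂ (StarPoly n)}

theorem star_eq (hp : IsUnitarySeminorm p) (x : StarPoly n) : p (star x) = p x := by
  have key : ∀ y : StarPoly n, p y ≤ p (star y) := by
    intro y
    have h1 := hp.star_mul_self y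
    have h2 := hp.mul_le (star y) y
    rcases (apply_nonneg p y).eq_or_lt with h | h
    · rw [← h]; exact apply_nonneg p _
    · nlinarith
  exact le_antisymm (by simpa using key (star x)) (key x)

theorem mono_le (hp : IsUnitarySeminorm p) (w : FreeMonoid (Letter n)) : p (mono w 1) ≤ 1 := by
  induction w using FreeMonoid.recOn with
  | one => rw [← one_eq_mono]; exact hp.one_le
  | of_mul x xs h =>
    have h1 : mono (FreeMonoid.of x * xs) 1 = mono (FreeMonoid.of x) 1 * mono xs 1 := by
      rw [mono_mul_mono, one_mul]
    have h2 : p (mono (FreeMonoid.of x) 1) ≤ 1 := by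
      obtain ⟨i, j, b⟩ := x
      cases b
      · exact hp.gen_le i j
      · rw [← star_polyGen, hp.star_eq]; exact hp.gen_le i j
    rw [h1]
    exact (hp.mul_le _ _).trans (mul_le_one₀ h2 (apply_nonneg p _) h)

end IsUnitarySeminorm

theorem bounded (x : StarPoly n) :
    ∃ C : ℝ, ∀ p : Seminorm ℂ (StarPoly n), IsUnitarySeminorm p → p x ≤ C := by
  induction x using poly_induction with
  | zero => exact ⟨0, fun p _ => by simp⟩
  | add x y hx hy =>
    obtain ⟨C, hC⟩ := hx
    obtain ⟨D, hD⟩ := hy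
    exact ⟨C + D, fun p hp => (map_add_le_add p x y).trans (add_le_add (hC p hp) (hD p hp))⟩
  | mono w c =>
    refine ⟨‖c‖, fun p hp => ?_⟩
    have : mono w c = c • mono w 1 := by rw [smul_mono, mul_one]
    rw [this, map_smul_eq_mul]
    exact mul_le_of_le_one_right (norm_nonneg c) (hp.mono_le w)

theorem isUnitarySeminorm_zero : IsUnitarySeminorm (0 : Seminorm ℂ (StarPoly n)) := by
  constructor <;> simp

instance : Nonempty {p : Seminorm ℂ (StarPoly n) // IsUnitarySeminorm p} :=
  ⟨⟨0, isUnitarySeminorm_zero⟩⟩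

/-- The universal C⋆-seminorm: the supremum of all C⋆-seminorms that satisfy the relations. -/
def univNorm (x : StarPoly n) : ℝ :=
  ⨆ p : {p : Seminorm ℂ (StarPoly n) // IsUnitarySeminorm p}, p.1 x

theorem le_univNorm {p : Seminorm ℂ (StarPoly n)} (hp : IsUnitarySeminorm p) (x : StarPoly n) :
    p x ≤ univNorm x := by
  obtain ⟨C, hC⟩ := bounded x
  exact le_ciSup (f := fun p : {p : Seminorm ℂ (StarPoly n) // IsUnitarySeminorm p} => p.1 x)
    ⟨C, by rintro _ ⟨q, rfl⟩; exact hC q.1 q.2⟩ ⟨p, hp⟩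

theorem univNorm_le {x : StarPoly n} {C : ℝ}
    (h : ∀ p : Seminorm ℂ (StarPoly n), IsUnitarySeminorm p → p x ≤ C) : univNorm x ≤ C :=
  ciSup_le fun p => h p.1 p.2

theorem univNorm_nonneg (x : StarPoly n) : 0 ≤ univNorm x := by
  simpa using le_univNorm isUnitarySeminorm_zero x

/-- `univNorm` as a seminorm. -/
def univSeminorm (n : ℕ) : Seminorm ℂ (StarPoly n) :=
  Seminorm.ofSMulLE univNorm
    (le_antisymm (univNorm_le fun p _ => by simp) (univNorm_nonneg 0))
    (fun x y => univNorm_le fun p hp => (map_add_le_add p x y).trans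
      (add_le_add (le_univNorm hp x) (le_univNorm hp y)))
    (fun c x => univNorm_le fun p hp => by
      rw [map_smul_eq_mul]
      exact mul_le_mul_of_nonneg_left (le_univNorm hp x) (norm_nonneg c))

theorem isUnitarySeminorm_univSeminorm : IsUnitarySeminorm (univSeminorm n) where
  one_le := univNorm_le fun _ hp => hp.one_le
  mul_le x y := univNorm_le fun p hp => (hp.mul_le x y).trans
    (mul_le_mul (le_univNorm hp x) (le_univNorm hp y) (apply_nonneg p y) (univNorm_nonneg x))
  star_mul_self x := by
    refine le_antisymm (univNorm_le fun p hp => ?_) ?_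
    · rw [hp.star_mul_self]
      exact mul_le_mul (le_univNorm hp x) (le_univNorm hp x) (apply_nonneg p x) (univNorm_nonneg x)
    · have h : univNorm x ≤ √(univNorm (star x * x)) := univNorm_le fun p hp => by
        refine Real.le_sqrt_of_sq_le ?_
        rw [sq, ← hp.star_mul_self]
        exact le_univNorm hp _
      calc univNorm x * univNorm x
          ≤ √(univNorm (star x * x)) * √(univNorm (star x * x)) :=
            mul_le_mul h h (univNorm_nonneg x) (Real.sqrt_nonneg _)
        _ = univNorm (star x * x) := Real.mul_self_sqrt (univNorm_nonneg _)
  gen_le i j := univNorm_le fun _ hp => hp.gen_le i j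
  rel_left i j := le_antisymm (univNorm_le fun _ hp => (hp.rel_left i j).le) (univNorm_nonneg _)
  rel_right i j := le_antisymm (univNorm_le fun _ hp => (hp.rel_right i j).le) (univNorm_nonneg _)

instance : SeminormedRing (StarPoly n) :=
  { AddGroupSeminorm.toSeminormedAddCommGroup (univSeminorm n).toAddGroupSeminorm,
    (inferInstance : Ring (StarPoly n)) with
    norm_mul_le := isUnitarySeminorm_univSeminorm.mul_le }

theorem norm_eq (x : StarPoly n) : ‖x‖ = univSeminorm n x := rfl

instance : NormedAlgebra ℂ (StarPoly n) where
  norm_smul_le c x := (map_smul_eq_mul (univSeminorm n) c x).le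

instance : NormedStarGroup (StarPoly n) where
  norm_star_le x := (isUnitarySeminorm_univSeminorm.star_eq x).le

end BrownAlgebra

open BrownAlgebra UniformSpace in
/-- The Brown algebra: the universal unital C⋆-algebra generated by the entries of an `n × n`
unitary matrix, i.e. the (separated) completion of the free `*`-algebra on `u i j` in the largest
C⋆-seminorm for which `(u i j)` is unitary. See `BrownAlgebra.existsUnique_lift` for the universal
property. -/
def BrownAlgebra (n : ℕ) : Type := UniformSpace.Completion (StarPoly n)

namespace BrownAlgebra

open UniformSpace

variable {n : ℕ}

instance : NormedRing (BrownAlgebra n) := inferInstanceAs (NormedRing (Completion (StarPoly n)))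

instance : Algebra ℂ (BrownAlgebra n) := inferInstanceAs (Algebra ℂ (Completion (StarPoly n)))

instance : NormedAlgebra ℂ (BrownAlgebra n) where
  norm_smul_le := norm_smul_le (α := ℂ) (β := Completion (StarPoly n))

instance : CompleteSpace (BrownAlgebra n) :=
  inferInstanceAs (CompleteSpace (Completion (StarPoly n)))

/-- The canonical map from the free `*`-algebra, with dense range. -/
def ofPoly : StarPoly n →ₐ[ℂ] BrownAlgebra n :=
  { Completion.coeRingHom with
    commutes' := fun _ => rfl }

theorem norm_ofPoly (x : StarPoly n) : ‖ofPoly x‖ = ‖x‖ := Completion.norm_coe x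

theorem denseRange_ofPoly : DenseRange (ofPoly : StarPoly n → BrownAlgebra n) :=
  Completion.denseRange_coe

theorem continuous_ofPoly : Continuous (ofPoly : StarPoly n → BrownAlgebra n) :=
  Completion.continuous_coe _

theorem uniformContinuous_polyStar : UniformContinuous (star : StarPoly n → StarPoly n) :=
  (starₗᵢ ℂ : StarPoly n ≃ₗᵢ⋆[ℂ] StarPoly n).isometry.uniformContinuous

instance : Star (BrownAlgebra n) := ⟨Completion.map star⟩

theorem star_ofPoly (x : StarPoly n) : star (ofPoly x) = ofPoly (star x) :=
  Completion.map_coe uniformContinuous_polyStar x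

theorem continuous_star' : Continuous (star : BrownAlgebra n → BrownAlgebra n) :=
  Completion.continuous_map

theorem ofPoly_induction {motive : BrownAlgebra n → Prop} (x : BrownAlgebra n)
    (hc : IsClosed {x | motive x}) (h : ∀ x, motive (ofPoly x)) : motive x :=
  Completion.induction_on (p := motive) x hc h

theorem ofPoly_induction₂ {motive : BrownAlgebra n → BrownAlgebra n → Prop} (x y : BrownAlgebra n)
    (hc : IsClosed {x : BrownAlgebra n × BrownAlgebra n | motive x.1 x.2})
    (h : ∀ x y, motive (ofPoly x) (ofPoly y)) : motive x y :=
  Completion.induction_on₂ (p := motive) x y hc h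

instance : StarRing (BrownAlgebra n) where
  star_involutive x := by
    induction x using ofPoly_induction with
    | hc => exact isClosed_eq (continuous_star'.comp continuous_star') continuous_id
    | h x => rw [star_ofPoly, star_ofPoly, star_star]
  star_mul x y := by
    induction x, y using ofPoly_induction₂ with
    | hc =>
      exact isClosed_eq (continuous_star'.comp (continuous_fst.mul continuous_snd))
        ((continuous_star'.comp continuous_snd).mul (continuous_star'.comp continuous_fst))
    | h x y => rw [← map_mul, star_ofPoly, star_ofPoly, star_ofPoly, star_mul, map_mul]
  star_add x y := by
    induction x, y using ofPoly_induction₂ with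
    | hc =>
      exact isClosed_eq (continuous_star'.comp (continuous_fst.add continuous_snd))
        ((continuous_star'.comp continuous_fst).add (continuous_star'.comp continuous_snd))
    | h x y => rw [← map_add, star_ofPoly, star_ofPoly, star_ofPoly, star_add, map_add]

instance : CStarRing (BrownAlgebra n) where
  norm_mul_self_le x := by
    induction x using ofPoly_induction with
    | hc =>
      exact isClosed_le (continuous_norm.mul continuous_norm)
        (continuous_norm.comp (continuous_star'.mul continuous_id))
    | h x =>
      rw [star_ofPoly, ← map_mul, norm_ofPoly, norm_ofPoly]
      exact (isUnitarySeminorm_univSeminorm.star_mul_self x).ge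

instance : StarModule ℂ (BrownAlgebra n) where
  star_smul c x := by
    induction x using ofPoly_induction with
    | hc =>
      exact isClosed_eq (continuous_star'.comp (continuous_const_smul c))
        ((continuous_const_smul (star c)).comp continuous_star')
    | h x => rw [← map_smul, star_ofPoly, star_ofPoly, star_smul, map_smul]

instance : CStarAlgebra (BrownAlgebra n) where

/-- The canonical generator `u i j` of the Brown algebra. -/
def gen (i j : Fin n) : BrownAlgebra n := ofPoly (polyGen i j)

theorem ofPoly_eq_zero {x : StarPoly n} (h : univSeminorm n x = 0) : ofPoly x = 0 := by
  rw [← norm_eq_zero, norm_ofPoly, norm_eq, h]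

/-- The matrix of generators is unitary. -/
theorem gen_mem_unitary :
    (Matrix.of gen : Matrix (Fin n) (Fin n) (BrownAlgebra n)) ∈
      unitary (Matrix (Fin n) (Fin n) (BrownAlgebra n)) := by
  have h0 : (Matrix.of gen : Matrix (Fin n) (Fin n) (BrownAlgebra n)) =
      (ofPoly : StarPoly n →ₐ[ℂ] BrownAlgebra n).mapMatrix (polyMatrix n) := by
    ext i j; rfl
  have h1 : star (Matrix.of gen : Matrix (Fin n) (Fin n) (BrownAlgebra n)) =
      (ofPoly : StarPoly n →ₐ[ℂ] BrownAlgebra n).mapMatrix (star (polyMatrix n)) := by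
    ext i j; exact star_ofPoly _
  rw [Unitary.mem_iff, h1, h0, ← map_mul, ← map_mul]
  constructor
  · rw [← sub_eq_zero, ← map_one (ofPoly : StarPoly n →ₐ[ℂ] BrownAlgebra n).mapMatrix, ← map_sub]
    ext i j
    exact ofPoly_eq_zero (isUnitarySeminorm_univSeminorm.rel_left i j)
  · rw [← sub_eq_zero, ← map_one (ofPoly : StarPoly n →ₐ[ℂ] BrownAlgebra n).mapMatrix, ← map_sub]
    ext i j
    exact ofPoly_eq_zero (isUnitarySeminorm_univSeminorm.rel_right i j)

section lift

variable {A : Type*} [CStarAlgebra A]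

/-- The value of a letter under the substitution `u i j ↦ a i j`. -/
def letterValue (a : Matrix (Fin n) (Fin n) A) (x : Letter n) : A :=
  if x.2.2 then star (a x.1 x.2.1) else a x.1 x.2.1

/-- Substitution `u i j ↦ a i j` in `*`-polynomials. -/
def evalPoly (a : Matrix (Fin n) (Fin n) A) : StarPoly n →ₐ[ℂ] A :=
  MonoidAlgebra.lift ℂ A (FreeMonoid (Letter n)) (FreeMonoid.lift (letterValue a))

theorem evalPoly_mono (a : Matrix (Fin n) (Fin n) A) (w : FreeMonoid (Letter n)) (c : ℂ) :
    evalPoly a (mono w c) = c • FreeMonoid.lift (letterValue a) w :=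
  MonoidAlgebra.lift_single _ _ _

theorem evalPoly_polyGen (a : Matrix (Fin n) (Fin n) A) (i j : Fin n) :
    evalPoly a (polyGen i j) = a i j := by
  rw [polyGen, evalPoly_mono]; simp [letterValue]

theorem lift_wordStar (a : Matrix (Fin n) (Fin n) A) (w : FreeMonoid (Letter n)) :
    FreeMonoid.lift (letterValue a) (wordStar w) = star (FreeMonoid.lift (letterValue a) w) := by
  induction w using FreeMonoid.recOn with
  | one => simp [wordStar_one]
  | of_mul x xs h =>
    obtain ⟨i, j, b⟩ := x
    rw [wordStar_mul, wordStar_of, map_mul, map_mul, star_mul, h]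
    cases b <;> simp [flip, letterValue]

theorem evalPoly_star (a : Matrix (Fin n) (Fin n) A) (x : StarPoly n) :
    evalPoly a (star x) = star (evalPoly a x) := by
  induction x using poly_induction with
  | zero => simp
  | add x y hx hy => rw [star_add, map_add, map_add, star_add, hx, hy]
  | mono w c =>
    rw [star_mono, evalPoly_mono, evalPoly_mono, star_smul, lift_wordStar, starRingEnd_apply]

theorem norm_one_le : ‖(1 : A)‖ ≤ 1 := by
  have h := CStarRing.norm_star_mul_self (x := (1 : A))
  rw [star_one, mul_one] at h
  nlinarith [norm_nonneg (1 : A)]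

theorem norm_entry_le {a : Matrix (Fin n) (Fin n) A}
    (ha : a ∈ unitary (Matrix (Fin n) (Fin n) A)) (i j : Fin n) : ‖a i j‖ ≤ 1 := by
  let _ : PartialOrder A := CStarAlgebra.spectralOrder A
  have _ : StarOrderedRing A := CStarAlgebra.spectralOrderedRing A
  have h1 : (star a * a) j j = 1 := by rw [(Unitary.mem_iff.1 ha).1]; simp
  rw [Matrix.mul_apply] at h1
  have h2 : star (a i j) * a i j ≤ 1 := by
    rw [← h1]
    exact Finset.single_le_sum (f := fun k => star a j k * a k j)
      (fun k _ => star_mul_self_nonneg (a k j)) (Finset.mem_univ i)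
  have h3 := (CStarAlgebra.norm_le_norm_of_nonneg_of_le (star_mul_self_nonneg (a i j)) h2).trans
    norm_one_le
  rw [CStarRing.norm_star_mul_self] at h3
  nlinarith [norm_nonneg (a i j)]

theorem evalPoly_polyMatrix (a : Matrix (Fin n) (Fin n) A) :
    (evalPoly a).mapMatrix (polyMatrix n) = a := by
  ext i j; exact evalPoly_polyGen a i j

theorem evalPoly_star_polyMatrix (a : Matrix (Fin n) (Fin n) A) :
    (evalPoly a).mapMatrix (star (polyMatrix n)) = star a := by
  ext i j
  exact (evalPoly_star a _).trans (congrArg star (evalPoly_polyGen a j i))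

theorem isUnitarySeminorm_evalPoly {a : Matrix (Fin n) (Fin n) A}
    (ha : a ∈ unitary (Matrix (Fin n) (Fin n) A)) :
    IsUnitarySeminorm ((normSeminorm ℂ A).comp (evalPoly a).toLinearMap) where
  one_le := by simpa using norm_one_le
  mul_le x y := by simpa using norm_mul_le (evalPoly a x) (evalPoly a y)
  star_mul_self x := by simp [evalPoly_star, CStarRing.norm_star_mul_self]
  gen_le i j := by simpa [evalPoly_polyGen] using norm_entry_le ha i j
  rel_left i j := by
    have h : (evalPoly a).mapMatrix (star (polyMatrix n) * polyMatrix n - 1) = 0 := by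
      rw [map_sub, map_mul, map_one, evalPoly_polyMatrix, evalPoly_star_polyMatrix,
        (Unitary.mem_iff.1 ha).1, sub_self]
    have h' : evalPoly a ((star (polyMatrix n) * polyMatrix n - 1) i j) = 0 :=
      congrFun (congrFun h i) j
    change ‖evalPoly a ((star (polyMatrix n) * polyMatrix n - 1) i j)‖ = 0
    rw [h', norm_zero]
  rel_right i j := by
    have h : (evalPoly a).mapMatrix (polyMatrix n * star (polyMatrix n) - 1) = 0 := by
      rw [map_sub, map_mul, map_one, evalPoly_polyMatrix, evalPoly_star_polyMatrix,
        (Unitary.mem_iff.1 ha).2, sub_self]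
    have h' : evalPoly a ((polyMatrix n * star (polyMatrix n) - 1) i j) = 0 :=
      congrFun (congrFun h i) j
    change ‖evalPoly a ((polyMatrix n * star (polyMatrix n) - 1) i j)‖ = 0
    rw [h', norm_zero]

theorem norm_evalPoly_le {a : Matrix (Fin n) (Fin n) A}
    (ha : a ∈ unitary (Matrix (Fin n) (Fin n) A)) (x : StarPoly n) : ‖evalPoly a x‖ ≤ ‖x‖ :=
  le_univNorm (isUnitarySeminorm_evalPoly ha) x

theorem uniformContinuous_evalPoly {a : Matrix (Fin n) (Fin n) A}
    (ha : a ∈ unitary (Matrix (Fin n) (Fin n) A)) : UniformContinuous (evalPoly a) :=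
  (AddMonoidHomClass.lipschitz_of_bound (evalPoly a) 1
    (by simpa using norm_evalPoly_le ha)).uniformContinuous

/-- The unital `*`-homomorphism with `u i j ↦ a i j`, for a unitary matrix `a`. -/
def lift (a : Matrix (Fin n) (Fin n) A) (ha : a ∈ unitary (Matrix (Fin n) (Fin n) A)) :
    BrownAlgebra n →⋆ₐ[ℂ] A :=
  let F : BrownAlgebra n →+* A :=
    Completion.extensionHom (evalPoly a).toRingHom (uniformContinuous_evalPoly ha).continuous
  have hF : ∀ x, F (ofPoly x) = evalPoly a x :=
    Completion.extension_coe (uniformContinuous_evalPoly ha)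
  have hc : Continuous F := Completion.continuous_extension
  { F with
    commutes' := fun r => by
      have := hF (algebraMap ℂ _ r)
      rw [AlgHom.commutes, AlgHom.commutes] at this
      exact this
    map_star' := fun x => by
      change F (star x) = star (F x)
      induction x using ofPoly_induction with
      | hc => exact isClosed_eq (hc.comp continuous_star') (continuous_star.comp hc)
      | h x => rw [star_ofPoly, hF, hF, evalPoly_star] }

theorem lift_ofPoly (a : Matrix (Fin n) (Fin n) A) (ha : a ∈ unitary (Matrix (Fin n) (Fin n) A))
    (x : StarPoly n) : lift a ha (ofPoly x) = evalPoly a x :=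
  Completion.extension_coe (uniformContinuous_evalPoly ha) x

theorem lift_gen (a : Matrix (Fin n) (Fin n) A) (ha : a ∈ unitary (Matrix (Fin n) (Fin n) A))
    (i j : Fin n) : lift a ha (gen i j) = a i j := by
  rw [gen, lift_ofPoly, evalPoly_polyGen]

theorem hom_ext {f g : BrownAlgebra n →⋆ₐ[ℂ] A} (h : ∀ i j, f (gen i j) = g (gen i j)) :
    f = g := by
  have key : ∀ w : FreeMonoid (Letter n), f (ofPoly (mono w 1)) = g (ofPoly (mono w 1)) := by
    intro w
    induction w using FreeMonoid.recOn with
    | one => rw [← one_eq_mono, map_one, map_one, map_one]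
    | of_mul x xs hx =>
      have h1 : mono (FreeMonoid.of x * xs) 1 = mono (FreeMonoid.of x) 1 * mono xs 1 := by
        rw [mono_mul_mono, one_mul]
      obtain ⟨i, j, b⟩ := x
      rw [h1, map_mul, map_mul, map_mul, hx]
      congr 1
      cases b
      · exact h i j
      · rw [← star_polyGen, ← star_ofPoly, map_star, map_star]
        exact congrArg star (h i j)
  have hcont : ∀ F : BrownAlgebra n →⋆ₐ[ℂ] A, Continuous F := fun F =>
    AddMonoidHomClass.continuous_of_bound F 1
      (by simpa using NonUnitalStarAlgHom.norm_apply_le F)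
  ext x
  induction x using ofPoly_induction with
  | hc => exact isClosed_eq (hcont f) (hcont g)
  | h x =>
    induction x using poly_induction with
    | zero => simp
    | add x y hx hy => simp only [map_add, hx, hy]
    | mono w c =>
      have : mono w c = c • mono w 1 := by rw [smul_mono, mul_one]
      rw [this, map_smul, map_smul, map_smul, key]

/-- The universal property: whenever `(a i j)` is a unitary matrix over a unital C⋆-algebra `A`,
there is a unique unital `*`-homomorphism with `u i j ↦ a i j`. -/
theorem existsUnique_lift (a : Matrix (Fin n) (Fin n) A)
    (ha : a ∈ unitary (Matrix (Fin n) (Fin n) A)) :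
    ∃! π : BrownAlgebra n →⋆ₐ[ℂ] A, ∀ i j, π (gen i j) = a i j :=
  ⟨lift a ha, lift_gen a ha, fun π hπ => hom_ext fun i j => by rw [hπ, lift_gen]⟩

end lift

end BrownAlgebra

/-- For a matrix `U = (U i j)` over a unital `*`-ring, the set `{1} ∪ {U i j, (U i j)⋆}`. -/
def entrySet {n : ℕ} {A : Type*} [Ring A] [StarRing A] (U : Matrix (Fin n) (Fin n) A) : Set A :=
  {x | x = 1 ∨ ∃ i j, x = U i j ∨ x = star (U i j)}

/-- A (concrete) operator system: a unital self-adjoint subspace of a unital C⋆-algebra. -/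
structure OperatorSystem (A : Type*) [CStarAlgebra A] extends Submodule ℂ A where
  one_mem' : (1 : A) ∈ carrier
  star_mem' : ∀ {x : A}, x ∈ carrier → star x ∈ carrier

namespace OperatorSystem

variable {A B : Type*} [CStarAlgebra A] [CStarAlgebra B]

/-- The order unit of an operator system. -/
def unit (S : OperatorSystem A) : S.toSubmodule := ⟨1, S.one_mem'⟩

/-- The cone `M_k(S)₊ = M_k(S) ∩ M_k(A)₊`, the positive elements of the C⋆-algebra `M_k(A)` being
those of the form `b⋆ b`. -/
def MatrixPos (S : OperatorSystem A) {k : ℕ} (X : Matrix (Fin k) (Fin k) S.toSubmodule) : Prop :=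
  ∃ b : Matrix (Fin k) (Fin k) A, X.map (fun x => (x : A)) = star b * b

/-- Unital completely positive maps `φ : S → M_p`: `φ 1 = 1`, and for all `k` the amplification
`φ⁽ᵏ⁾ : M_k(S) → M_k(M_p) = M_{kp}` maps positive elements to positive semidefinite matrices. -/
def IsUCP (S : OperatorSystem A) {p : ℕ}
    (φ : S.toSubmodule →ₗ[ℂ] Matrix (Fin p) (Fin p) ℂ) : Prop :=
  φ S.unit = 1 ∧ ∀ (k : ℕ) (X : Matrix (Fin k) (Fin k) S.toSubmodule), S.MatrixPos X →
    (Matrix.of fun a b : Fin k × Fin p => φ (X a.1 b.1) a.2 b.2).PosSemidef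

/-- The map `φ ⊗ ψ : S ⊗ T → M_p ⊗ M_q = M_{pq}` (Kronecker product). -/
def tensorMap {S : OperatorSystem A} {T : OperatorSystem B} {p q : ℕ}
    (φ : S.toSubmodule →ₗ[ℂ] Matrix (Fin p) (Fin p) ℂ)
    (ψ : T.toSubmodule →ₗ[ℂ] Matrix (Fin q) (Fin q) ℂ) :
    S.toSubmodule ⊗[ℂ] T.toSubmodule →ₗ[ℂ] Matrix (Fin p × Fin q) (Fin p × Fin q) ℂ :=
  TensorProduct.lift ((Matrix.kroneckerBilinear (R := ℂ) (α := ℂ)).compl₁₂ φ ψ)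

/-- The positive elements of the minimal tensor product `S ⊗_min T`: those `X` with
`(φ ⊗ ψ)(X) ≥ 0` for all ucp maps `φ : S → M_p` and `ψ : T → M_q`.
(Such an `X` is automatically self-adjoint.) -/
def MinPos (S : OperatorSystem A) (T : OperatorSystem B)
    (X : S.toSubmodule ⊗[ℂ] T.toSubmodule) : Prop :=
  ∀ (p q : ℕ) (φ : S.toSubmodule →ₗ[ℂ] Matrix (Fin p) (Fin p) ℂ)
    (ψ : T.toSubmodule →ₗ[ℂ] Matrix (Fin q) (Fin q) ℂ),
    S.IsUCP φ → T.IsUCP ψ → (tensorMap φ ψ X).PosSemidef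

/-- The positive elements of the maximal tensor product `S ⊗_max T`: those `X` such that for every
`ε > 0` there are `P ∈ M_p(S)₊`, `Q ∈ M_q(T)₊` and `a : ℂ → ℂ^p ⊗ ℂ^q` with
`X + ε (1 ⊗ 1) = a⋆ (P ⊗ Q) a`. (Such an `X` is automatically self-adjoint.) -/
def MaxPos (S : OperatorSystem A) (T : OperatorSystem B)
    (X : S.toSubmodule ⊗[ℂ] T.toSubmodule) : Prop :=
  ∀ ε : ℝ, 0 < ε → ∃ (p q : ℕ) (P : Matrix (Fin p) (Fin p) S.toSubmodule)
    (Q : Matrix (Fin q) (Fin q) T.toSubmodule) (a : Fin p × Fin q → ℂ),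
    S.MatrixPos P ∧ T.MatrixPos Q ∧
    X + (ε : ℂ) • (S.unit ⊗ₜ[ℂ] T.unit) =
      ∑ i, ∑ j, (conj (a i) * a j) • (P i.1 j.1 ⊗ₜ[ℂ] Q i.2 j.2)

/-- `s` is a state on `S ⊗ T` with respect to the cone `pos`: a unital positive functional. -/
def IsState {S : OperatorSystem A} {T : OperatorSystem B}
    (pos : S.toSubmodule ⊗[ℂ] T.toSubmodule → Prop)
    (s : S.toSubmodule ⊗[ℂ] T.toSubmodule →ₗ[ℂ] ℂ) : Prop :=
  s (S.unit ⊗ₜ[ℂ] T.unit) = 1 ∧ ∀ X, pos X → 0 ≤ s X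

end OperatorSystem

theorem star_mem_span_entrySet {n : ℕ} {A : Type*} [CStarAlgebra A] (U : Matrix (Fin n) (Fin n) A)
    {x : A} (hx : x ∈ Submodule.span ℂ (entrySet U)) :
    star x ∈ Submodule.span ℂ (entrySet U) := by
  induction hx using Submodule.span_induction with
  | mem x h =>
    refine Submodule.subset_span ?_
    rcases h with rfl | ⟨i, j, rfl | rfl⟩
    · exact Or.inl (star_one A)
    · exact Or.inr ⟨i, j, Or.inr rfl⟩
    · exact Or.inr ⟨i, j, Or.inl (star_star _)⟩
  | zero => simp
  | add x y _ _ hx hy => rw [star_add]; exact Submodule.add_mem _ hx hy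
  | smul c x _ hx => rw [star_smul]; exact Submodule.smul_mem _ _ hx

/-- The operator system `V_n = span {1, u i j, (u i j)⋆}` in the Brown algebra. -/
def unitarySystem (n : ℕ) : OperatorSystem (BrownAlgebra n) where
  toSubmodule := Submodule.span ℂ (entrySet (Matrix.of BrownAlgebra.gen))
  one_mem' := Submodule.subset_span (Or.inl rfl)
  star_mem' := star_mem_span_entrySet _

/-- The generator `u i j` as an element of `V_n`. -/
def unitarySystem.gen {n : ℕ} (i j : Fin n) : (unitarySystem n).toSubmodule :=
  ⟨BrownAlgebra.gen i j, Submodule.subset_span (Or.inr ⟨i, j, Or.inl rfl⟩)⟩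

/-- The algebraic tensor product `M_n ⊗ M_m`. -/
abbrev MatTensor (n m : ℕ) : Type :=
  Matrix (Fin n) (Fin n) ℂ ⊗[ℂ] Matrix (Fin m) (Fin m) ℂ

/-- The element `∑ x i j k l • (E i j ⊗ E k l)` of `M_n ⊗ M_m` with coordinates `x i j k l`. -/
def ofCoords {n m : ℕ} (x : Fin n → Fin n → Fin m → Fin m → ℂ) : MatTensor n m :=
  ∑ i, ∑ j, ∑ k, ∑ l, x i j k l • (Matrix.single i j (1 : ℂ) ⊗ₜ[ℂ] Matrix.single k l (1 : ℂ))

/-- `B_qc(n,m)`: all `(⟨U i j V k l ψ, ψ⟩)` with unitaries `U ∈ M_n(B(H))`, `V ∈ M_m(B(H))` such that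
`1, U i j, (U i j)⋆` commute with `1, V k l, (V k l)⋆`, and a unit vector `ψ` of the Hilbert space
`H`. (Mathlib's inner product is conjugate-linear in the first variable.) -/
def Bqc (n m : ℕ) : Set (MatTensor n m) :=
  {X | ∃ (H : Type u) (_ : NormedAddCommGroup H) (_ : InnerProductSpace ℂ H) (_ : CompleteSpace H)
    (U : Matrix (Fin n) (Fin n) (H →L[ℂ] H)) (V : Matrix (Fin m) (Fin m) (H →L[ℂ] H)) (ψ : H),
    U ∈ unitary (Matrix (Fin n) (Fin n) (H →L[ℂ] H)) ∧
    V ∈ unitary (Matrix (Fin m) (Fin m) (H →L[ℂ] H)) ∧ ‖ψ‖ = 1 ∧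
    (∀ x ∈ entrySet U, ∀ y ∈ entrySet V, x * y = y * x) ∧
    X = ofCoords fun i j k l => inner ℂ ψ ((U i j * V k l) ψ)}

/-- `B_loc(n,m)`: as `B_qc(n,m)`, but with the C⋆-algebra generated by all the entries of `U` and
`V` commutative. -/
def Bloc (n m : ℕ) : Set (MatTensor n m) :=
  {X | ∃ (H : Type u) (_ : NormedAddCommGroup H) (_ : InnerProductSpace ℂ H) (_ : CompleteSpace H)
    (U : Matrix (Fin n) (Fin n) (H →L[ℂ] H)) (V : Matrix (Fin m) (Fin m) (H →L[ℂ] H)) (ψ : H),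
    U ∈ unitary (Matrix (Fin n) (Fin n) (H →L[ℂ] H)) ∧
    V ∈ unitary (Matrix (Fin m) (Fin m) (H →L[ℂ] H)) ∧ ‖ψ‖ = 1 ∧
    (∀ x ∈ entrySet U, ∀ y ∈ entrySet V, x * y = y * x) ∧
    (∀ x ∈ (StarAlgebra.adjoin ℂ (entrySet U ∪ entrySet V)).topologicalClosure,
      ∀ y ∈ (StarAlgebra.adjoin ℂ (entrySet U ∪ entrySet V)).topologicalClosure,
        x * y = y * x) ∧
    X = ofCoords fun i j k l => inner ℂ ψ ((U i j * V k l) ψ)}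

/-- `B_qa(n,m)`: all `(s (u i j ⊗ v k l))` with `s` a state on `V_n ⊗_min V_m`. -/
def Bqa (n m : ℕ) : Set (MatTensor n m) :=
  {X | ∃ s : (unitarySystem n).toSubmodule ⊗[ℂ] (unitarySystem m).toSubmodule →ₗ[ℂ] ℂ,
    OperatorSystem.IsState (OperatorSystem.MinPos (unitarySystem n) (unitarySystem m)) s ∧
    X = ofCoords fun i j k l => s (unitarySystem.gen i j ⊗ₜ[ℂ] unitarySystem.gen k l)}

/-- `B_qmax(n,m)`: all `(s (u i j ⊗ v k l))` with `s` a state on `V_n ⊗_max V_m`. -/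
def Bqmax (n m : ℕ) : Set (MatTensor n m) :=
  {X | ∃ s : (unitarySystem n).toSubmodule ⊗[ℂ] (unitarySystem m).toSubmodule →ₗ[ℂ] ℂ,
    OperatorSystem.IsState (OperatorSystem.MaxPos (unitarySystem n) (unitarySystem m)) s ∧
    X = ofCoords fun i j k l => s (unitarySystem.gen i j ⊗ₜ[ℂ] unitarySystem.gen k l)}

/-- The four types of correlations. -/
inductive CorrelationType : Type
  | loc
  | qa
  | qc
  | qmax

/-- The unitary correlation sets `B_t(n,m)`. -/
def correlationSet (t : CorrelationType) (n m : ℕ) : Set (MatTensor n m) :=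
  match t with
  | .loc => Bloc.{u} n m
  | .qa => Bqa n m
  | .qc => Bqc.{u} n m
  | .qmax => Bqmax n m

open scoped Matrix.Norms.L2Operator in
/-- The projective Banach space tensor norm on `M_n ⊗ M_m`, where `M_n` and `M_m` carry the operator
norm: the infimum of `∑ ‖x i‖ ‖y i‖` over all representations `X = ∑ x i ⊗ y i`. -/
def projectiveTensorNorm {n m : ℕ} (X : MatTensor n m) : ℝ :=
  sInf {r : ℝ | ∃ (d : ℕ) (x : Fin d → Matrix (Fin n) (Fin n) ℂ)
    (y : Fin d → Matrix (Fin m) (Fin m) ℂ),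
    X = ∑ i, x i ⊗ₜ[ℂ] y i ∧ r = ∑ i, ‖x i‖ * ‖y i‖}

end

/-! A compact convex subset of the finite-dimensional space `M_n ⊗ M_m` that is invariant under the
unit circle and spans the space is the closed unit ball of its gauge, and this gauge is a norm
(`exists_norm_unitBall`). All four sets are of this kind. Circle invariance comes from replacing `U`
by `z • U`. Spanning holds because each set contains every `x ⊗ y` with `x`, `y` scalar unitaries,
and the unitaries span a matrix algebra.

Convexity and compactness follow once the set consists of the values of all states of one fixed
space on fixed vectors: states form a convex set, and it is compact for pointwise convergence as
soon as they are pointwise bounded. For `qa` and `qmax` this description is the definition. For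
`loc` and `qc` the Hilbert space varies. There, one C⋆-algebraic model is chosen for each attained
correlation, and the ℓ^∞-product of these models, with an arbitrary state, is again a model
(`UnitaryModel.exists_range_coords_eq_stateCoords`). The GNS construction returns from states to
unit vectors.

The identification of the `loc` norm has two halves. In a commutative C⋆-algebra, characters send
the pair `(U, V)` to scalar unitaries, so a real-linear bound on the products of unitaries persists
on all of `B_loc`. By Hahn–Banach, `B_loc` lies in the gauge ball of the convex hull of these
products, and points of that hull have explicit representations of projective norm at most one
(`UnitaryModel.gauge_coords_le_one`, `exists_representation_of_mem_convexHull`). Conversely, a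
Russo–Dye argument shows that a seminorm which is at most one on unitaries is at most the operator
norm. Used in each variable, it bounds the norm of `x ⊗ y` by `‖x‖ * ‖y‖`
(`Seminorm.le_mul_norm_of_unitary`). -/

open scoped TensorProduct ComplexConjugate ComplexOrder Pointwise ENNReal

/-! ### Convexity and compactness of the values of states. -/

section states

variable {V : Type*} [AddCommGroup V] [Module ℂ V]

/-- `s` is a normalized linear functional that is nonnegative on `pos`. -/
def IsNormalizedPositive (e : V) (pos : V → Prop) (s : V →ₗ[ℂ] ℂ) : Prop :=
  s e = 1 ∧ ∀ x, pos x → 0 ≤ s x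

/-- The coordinates of the elements of `M_n ⊗ M_m`. -/
abbrev Coords (n m : ℕ) : Type := Fin n → Fin n → Fin m → Fin m → ℂ

/-- The values on the family `g` of the normalized positive functionals. -/
def stateCoords {n m : ℕ} (e : V) (pos : V → Prop) (g : Fin n → Fin n → Fin m → Fin m → V) :
    Set (Coords n m) :=
  {x | ∃ s : V →ₗ[ℂ] ℂ, IsNormalizedPositive e pos s ∧ x = fun i j k l => s (g i j k l)}

variable {n m : ℕ} {e : V} {pos : V → Prop} {g : Fin n → Fin n → Fin m → Fin m → V}

theorem convex_stateCoords : Convex ℝ (stateCoords e pos g) := by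
  rintro _ ⟨s, ⟨hs1, hs⟩, rfl⟩ _ ⟨t, ⟨ht1, ht⟩, rfl⟩ a b ha hb hab
  refine ⟨(a : ℂ) • s + (b : ℂ) • t, ⟨?_, fun x hx => ?_⟩, ?_⟩
  · simp only [LinearMap.add_apply, LinearMap.smul_apply, hs1, ht1, smul_eq_mul, mul_one]
    exact_mod_cast hab
  · simp only [LinearMap.add_apply, LinearMap.smul_apply, smul_eq_mul]
    exact add_nonneg (mul_nonneg (by exact_mod_cast ha) (hs x hx))
      (mul_nonneg (by exact_mod_cast hb) (ht x hx))
  · ext i j k l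
    simp

/-- Tychonoff: pointwise bounds place the functionals in a product of closed discs, and linearity,
normalization and positivity are closed conditions on functions `V → ℂ`. No topology on `V` is
involved, and evaluation at the vectors of `g` is continuous. -/
theorem isCompact_stateCoords
    (hb : ∀ v, ∃ C : ℝ, ∀ s : V →ₗ[ℂ] ℂ, IsNormalizedPositive e pos s → ‖s v‖ ≤ C) :
    IsCompact (stateCoords e pos g) := by
  choose C hC using hb
  let K : Set (V → ℂ) := {f | (∀ x y, f (x + y) = f x + f y) ∧ (∀ (c : ℂ) x, f (c • x) = c * f x) ∧
    f e = 1 ∧ (∀ x, pos x → 0 ≤ f x) ∧ ∀ x, ‖f x‖ ≤ C x}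
  have hK : IsCompact K := by
    refine (isCompact_univ_pi fun x => isCompact_closedBall (0 : ℂ) (C x)).of_isClosed_subset ?_
      fun f hf x _ => by simpa using hf.2.2.2.2 x
    refine IsClosed.and ?_ (IsClosed.and ?_ (IsClosed.and ?_ (IsClosed.and ?_ ?_)))
    · simp only [Set.ofPred_forall]
      exact isClosed_iInter fun x =>
        isClosed_iInter fun y => isClosed_eq (by fun_prop) (by fun_prop)
    · simp only [Set.ofPred_forall]
      exact isClosed_iInter fun x =>
        isClosed_iInter fun y => isClosed_eq (by fun_prop) (by fun_prop)
    · exact isClosed_eq (by fun_prop) (by fun_prop)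
    · simp only [Set.ofPred_forall]
      exact isClosed_iInter fun x =>
        isClosed_iInter fun _ => isClosed_le (by fun_prop) (by fun_prop)
    · simp only [Set.ofPred_forall]
      exact isClosed_iInter fun x => isClosed_le (by fun_prop) (by fun_prop)
  have himage : stateCoords e pos g = (fun f : V → ℂ => fun i j k l => f (g i j k l)) '' K := by
    ext x
    constructor
    · rintro ⟨s, hs, rfl⟩
      exact ⟨s, ⟨map_add s, fun c x => by simp, hs.1, hs.2, fun x => hC x s hs⟩, rfl⟩
    · rintro ⟨f, ⟨h1, h2, h3, h4, -⟩, rfl⟩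
      exact ⟨{ toFun := f, map_add' := h1, map_smul' := h2 }, ⟨h3, h4⟩, rfl⟩
  rw [himage]
  exact hK.image (by fun_prop)

end states

/-! ### Coordinates on the tensor product, and products of scalar unitaries. -/

section coordinates

variable {n m : ℕ}

/-- The coordinates of a product `x ⊗ y`. -/
def prodCoords (x : Matrix (Fin n) (Fin n) ℂ) (y : Matrix (Fin m) (Fin m) ℂ) : Coords n m :=
  fun i j k l => x i j * y k l

theorem ofCoords_prodCoords (x : Matrix (Fin n) (Fin n) ℂ) (y : Matrix (Fin m) (Fin m) ℂ) :
    ofCoords (prodCoords x y) = x ⊗ₜ[ℂ] y := by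
  conv_rhs => rw [Matrix.matrix_eq_sum_single x, Matrix.matrix_eq_sum_single y]
  simp_rw [TensorProduct.sum_tmul, TensorProduct.tmul_sum, ofCoords, prodCoords]
  refine Finset.sum_congr rfl fun i _ => Finset.sum_congr rfl fun j _ => Finset.sum_congr rfl
    fun k _ => Finset.sum_congr rfl fun l _ => ?_
  have h1 : Matrix.single i j (x i j) = x i j • Matrix.single i j (1 : ℂ) := by
    rw [Matrix.smul_single, smul_eq_mul, mul_one]
  have h2 : Matrix.single k l (y k l) = y k l • Matrix.single k l (1 : ℂ) := by
    rw [Matrix.smul_single, smul_eq_mul, mul_one]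
  rw [h1, h2, TensorProduct.smul_tmul_smul]

/-- `ofCoords` as a linear map. -/
def ofCoordsLinear (n m : ℕ) : Coords n m →ₗ[ℂ] MatTensor n m where
  toFun := ofCoords
  map_add' x y := by simp [ofCoords, add_smul, Finset.sum_add_distrib]
  map_smul' c x := by simp [ofCoords, mul_smul, Finset.smul_sum]

/-- The coordinates of an element of `M_n ⊗ M_m`. -/
def toCoords (n m : ℕ) : MatTensor n m →ₗ[ℂ] Coords n m :=
  TensorProduct.lift (LinearMap.mk₂ ℂ prodCoords
    (fun x x' y => by ext; simp [prodCoords, add_mul])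
    (fun c x y => by ext; simp [prodCoords, mul_assoc])
    (fun x y y' => by ext; simp [prodCoords, mul_add])
    (fun c x y => by ext; simp [prodCoords, mul_left_comm]))

theorem toCoords_tmul (x : Matrix (Fin n) (Fin n) ℂ) (y : Matrix (Fin m) (Fin m) ℂ) :
    toCoords n m (x ⊗ₜ[ℂ] y) = prodCoords x y := rfl

/-- `M_n ⊗ M_m` is the space of coordinates. -/
def coordsEquiv (n m : ℕ) : MatTensor n m ≃ₗ[ℂ] Coords n m where
  __ := toCoords n m
  invFun := ofCoords
  left_inv X := by
    change ofCoords (toCoords n m X) = X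
    induction X using TensorProduct.induction_on with
    | zero => rw [map_zero]; exact map_zero (ofCoordsLinear n m)
    | tmul x y => rw [toCoords_tmul, ofCoords_prodCoords]
    | add x y hx hy =>
      rw [map_add]
      exact (map_add (ofCoordsLinear n m) _ _).trans (congrArg₂ _ hx hy)
  right_inv x := by
    change toCoords n m (ofCoords x) = x
    ext i j k l
    simp only [ofCoords, map_sum, map_smul, toCoords_tmul, Finset.sum_apply, Pi.smul_apply,
      prodCoords, Matrix.single_apply, smul_eq_mul]
    rw [Finset.sum_eq_single i, Finset.sum_eq_single j, Finset.sum_eq_single k,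
      Finset.sum_eq_single l] <;> simp +contextual

theorem coordsEquiv_tmul (x : Matrix (Fin n) (Fin n) ℂ) (y : Matrix (Fin m) (Fin m) ℂ) :
    coordsEquiv n m (x ⊗ₜ[ℂ] y) = prodCoords x y := rfl

theorem coordsEquiv_symm_apply (x : Coords n m) : (coordsEquiv n m).symm x = ofCoords x := rfl

/-- The products of two unitaries. -/
def unitaryProducts (n m : ℕ) : Set (Coords n m) :=
  Set.image2 prodCoords (unitary (Matrix (Fin n) (Fin n) ℂ) : Set (Matrix (Fin n) (Fin n) ℂ))
    (unitary (Matrix (Fin m) (Fin m) ℂ) : Set (Matrix (Fin m) (Fin m) ℂ))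

-- Unitaries span each matrix algebra linearly, so their elementary tensors span the tensor product.
open scoped Matrix.Norms.L2Operator in
theorem span_unitaryProducts : Submodule.span ℂ (unitaryProducts n m) = ⊤ := by
  have h : (unitaryProducts n m) = coordsEquiv n m '' Set.image2 (fun x y => x ⊗ₜ[ℂ] y)
      (unitary (Matrix (Fin n) (Fin n) ℂ) : Set (Matrix (Fin n) (Fin n) ℂ))
      (unitary (Matrix (Fin m) (Fin m) ℂ) : Set (Matrix (Fin m) (Fin m) ℂ)) := by
    rw [Set.image_image2]; rfl
  rw [h, ← LinearEquiv.coe_coe, Submodule.span_image]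
  have h2 : Submodule.span ℂ (Set.image2 (fun x y => x ⊗ₜ[ℂ] y)
      (unitary (Matrix (Fin n) (Fin n) ℂ) : Set (Matrix (Fin n) (Fin n) ℂ))
      (unitary (Matrix (Fin m) (Fin m) ℂ) : Set (Matrix (Fin m) (Fin m) ℂ))) = ⊤ := by
    have := Submodule.map₂_span_span ℂ (TensorProduct.mk ℂ (Matrix (Fin n) (Fin n) ℂ)
      (Matrix (Fin m) (Fin m) ℂ))
      (unitary (Matrix (Fin n) (Fin n) ℂ) : Set (Matrix (Fin n) (Fin n) ℂ))
      (unitary (Matrix (Fin m) (Fin m) ℂ) : Set (Matrix (Fin m) (Fin m) ℂ))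
    rw [CStarAlgebra.span_unitary, CStarAlgebra.span_unitary,
      TensorProduct.map₂_mk_top_top_eq_top] at this
    exact this.symm
  rw [h2, Submodule.map_top, LinearEquiv.range]

theorem smul_mem_unitary_of_norm_eq_one {R : Type*} [Ring R] [StarRing R] [Algebra ℂ R]
    [StarModule ℂ R] {z : ℂ} (hz : ‖z‖ = 1) {a : R} (ha : a ∈ unitary R) : z • a ∈ unitary R := by
  have h : conj z * z = 1 := by
    rw [← Complex.normSq_eq_conj_mul_self, Complex.normSq_eq_norm_sq, hz]
    simp
  rw [Unitary.mem_iff] at ha ⊢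
  rw [star_smul, smul_mul_smul_comm, smul_mul_smul_comm, ha.1, ha.2, ← starRingEnd_apply,
    mul_comm z, h, one_smul]
  exact ⟨rfl, rfl⟩

theorem smul_mem_unitaryProducts {z : ℂ} (hz : ‖z‖ = 1) {x : Coords n m}
    (hx : x ∈ unitaryProducts n m) : z • x ∈ unitaryProducts n m := by
  obtain ⟨a, ha, b, hb, rfl⟩ := hx
  refine ⟨z • a, ?_, b, hb, by ext; simp [prodCoords, mul_assoc]⟩
  exact smul_mem_unitary_of_norm_eq_one hz ha

end coordinates

/-! ### Norms obtained as gauges. -/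

section gauge

theorem Convex.balanced_of_circle {E : Type*} [AddCommGroup E] [Module ℂ E] {s : Set E}
    (hs : Convex ℝ s) (h : ∀ z : ℂ, ‖z‖ = 1 → ∀ x ∈ s, z • x ∈ s) : Balanced ℂ s := by
  rintro c hc _ ⟨x, hx, rfl⟩
  -- Shrinking uses only the points `y` and `-y` of `s`: `r • y` is their convex combination with
  -- weights `(1 + r) / 2` and `(1 - r) / 2`.
  have key : ∀ r : ℝ, 0 ≤ r → r ≤ 1 → ∀ y ∈ s, r • y ∈ s := by
    intro r h0 h1 y hy
    have h2 := hs hy (h (-1) (by simp) y hy) (a := (1 + r) / 2) (b := (1 - r) / 2)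
      (by linarith) (by linarith) (by ring)
    convert h2 using 1
    rw [neg_one_smul]
    module
  rcases eq_or_ne c 0 with rfl | h0
  · have := key 0 le_rfl zero_le_one x hx
    simpa using this
  · have h1 : c • x = ‖c‖ • ((c / ‖c‖ : ℂ) • x) := by
      rw [← Complex.coe_smul, smul_smul, mul_div_cancel₀]
      exact_mod_cast (norm_pos_iff.2 h0).ne'
    change c • x ∈ s
    rw [h1]
    refine key _ (norm_nonneg _) hc _ (h _ ?_ x hx)
    simp [h0]

/-- The union of the dilates `r • s`, `r > 0`, is a complex subspace: convexity gives sums through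
`(r + t) • s = r • s + t • s`, and balancedness gives scalar multiples. -/
theorem absorbent_of_span_eq_top {E : Type*} [AddCommGroup E] [Module ℂ E] {s : Set E}
    (hb : Balanced ℂ s) (hs : Convex ℝ s) (hne : s.Nonempty)
    (hspan : Submodule.span ℂ s = ⊤) : Absorbent ℝ s := by
  have h0 : (0 : E) ∈ s := hb.zero_mem hne
  have key : ∀ x : E, ∃ r : ℝ, 0 < r ∧ x ∈ r • s := by
    intro x
    have hx : x ∈ Submodule.span ℂ s := hspan ▸ Submodule.mem_top
    induction hx using Submodule.span_induction with
    | mem x hx => exact ⟨1, one_pos, by simpa using hx⟩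
    | zero => exact ⟨1, one_pos, by simpa using h0⟩
    | add x y _ _ hx hy =>
      obtain ⟨r, hr, hx⟩ := hx
      obtain ⟨t, ht, hy⟩ := hy
      refine ⟨r + t, by positivity, ?_⟩
      rw [hs.add_smul hr.le ht.le]
      exact Set.add_mem_add hx hy
    | smul c x _ hx =>
      obtain ⟨r, hr, y, hy, rfl⟩ := hx
      -- Dividing by `‖c‖ + 1` instead of `‖c‖` keeps the dilation factor positive when `c = 0`.
      refine ⟨r * (‖c‖ + 1), by positivity, (c / (‖c‖ + 1 : ℝ) : ℂ) • y, hb _ ?_ ⟨y, hy, rfl⟩, ?_⟩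
      · rw [norm_div, Complex.norm_real, Real.norm_of_nonneg (by positivity)]
        exact (div_le_one (by positivity)).2 (by linarith)
      · have h1 : ((‖c‖ + 1 : ℝ) : ℂ) ≠ 0 := by
          exact_mod_cast (by positivity : (0 : ℝ) < ‖c‖ + 1).ne'
        change (r * (‖c‖ + 1)) • ((c / (‖c‖ + 1 : ℝ) : ℂ) • y) = c • (r • y)
        rw [← Complex.coe_smul, ← Complex.coe_smul, smul_smul, smul_smul]
        congr 1
        push_cast at h1 ⊢
        field_simp
  rw [absorbent_iff_forall_absorbs_singleton]
  intro x
  obtain ⟨r, hr, y, hy, rfl⟩ := key x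
  refine Absorbs.of_norm ⟨r, fun c hc => ?_⟩
  have hc0 : c ≠ 0 := by rintro rfl; simp at hc; linarith
  rw [Set.singleton_subset_iff]
  refine ⟨(r / c : ℝ) • y, ?_, by simp [smul_smul, mul_div_cancel₀ _ hc0]⟩
  rw [← Complex.coe_smul]
  refine hb _ ?_ ⟨y, hy, rfl⟩
  rw [Complex.norm_real, norm_div, div_le_one (norm_pos_iff.2 hc0), Real.norm_of_nonneg hr.le]
  exact hc

variable {n m : ℕ} {C : Set (Coords n m)}

theorem unitaryProducts_nonempty : (unitaryProducts n m).Nonempty :=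
  ⟨_, 1, one_mem _, 1, one_mem _, rfl⟩

theorem absorbent_of_unitaryProducts_subset (hs : Convex ℝ C) (hb : Balanced ℂ C)
    (hu : unitaryProducts n m ⊆ C) : Absorbent ℝ C :=
  absorbent_of_span_eq_top hb hs (unitaryProducts_nonempty.mono hu)
    (top_le_iff.1 (span_unitaryProducts.symm.trans_le (Submodule.span_mono hu)))

/-- A compact convex circle-invariant set that contains the products of unitaries is the unit ball
of a norm. -/
theorem exists_norm_unitBall (hs : Convex ℝ C) (hC : IsCompact C)
    (hz : ∀ z : ℂ, ‖z‖ = 1 → ∀ x ∈ C, z • x ∈ C) (hu : unitaryProducts n m ⊆ C) :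
    ∃ ν : Seminorm ℂ (MatTensor n m), (∀ X, ν X = 0 → X = 0) ∧ {X | ν X ≤ 1} = ofCoords '' C := by
  have hb := hs.balanced_of_circle hz
  have ha := absorbent_of_unitaryProducts_subset hs hb hu
  have h0 : (0 : Coords n m) ∈ C := hb.zero_mem (unitaryProducts_nonempty.mono hu)
  refine ⟨(gaugeSeminorm hb hs ha).comp (coordsEquiv n m).toLinearMap, fun X hX => ?_, ?_⟩
  · have h1 : gauge C (coordsEquiv n m X) = 0 := hX
    -- Boundedness of `C` makes the gauge definite; its closedness, used next, makes the gauge ball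
    -- equal to `C` and not merely to its closure.
    rw [gauge_eq_zero ha ((NormedSpace.isVonNBounded_iff ℝ).2 hC.isBounded)] at h1
    simpa using h1
  · ext X
    constructor
    · intro h
      have h1 : coordsEquiv n m X ∈ C :=
        hC.isClosed.closure_eq ▸ mem_closure_of_gauge_le_one hs h0 ha h
      exact ⟨_, h1, (coordsEquiv n m).symm_apply_apply X⟩
    · rintro ⟨x, hx, rfl⟩
      change gauge C (coordsEquiv n m ((coordsEquiv n m).symm x)) ≤ 1
      rw [LinearEquiv.apply_symm_apply]
      exact gauge_le_one_of_mem hx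

end gauge

/-! ### Bounds for states of a C⋆-algebra. -/

section positivity

variable {A : Type*} [CStarAlgebra A]

/-- Since `-x ≤ ‖x‖ ≤ r` in the spectral order, the sum is nonnegative and hence has this form. -/
theorem exists_star_mul_self_of_norm_le {x : A} (hx : IsSelfAdjoint x) {r : ℝ} (hr : ‖x‖ ≤ r) :
    ∃ b : A, (r : ℂ) • (1 : A) + x = star b * b := by
  let _ : PartialOrder A := CStarAlgebra.spectralOrder A
  have _ : StarOrderedRing A := CStarAlgebra.spectralOrderedRing A
  rw [← CStarAlgebra.nonneg_iff_eq_star_mul_self]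
  have h1 := (IsSelfAdjoint.le_algebraMap_norm_self (hx.neg))
  rw [norm_neg, neg_le_iff_add_nonneg', add_comm] at h1
  have h2 : (0 : A) ≤ algebraMap ℝ A (r - ‖x‖) :=
    algebraMap_nonneg A (sub_nonneg.2 hr)
  have h3 := add_nonneg h1 h2
  convert h3 using 1
  rw [map_sub, Complex.coe_smul, ← Algebra.algebraMap_eq_smul_one]
  abel

/-- A normalized functional that is nonnegative on the elements `star b * b` is bounded. -/
theorem exists_bound_of_normalizedPositive (v : A) :
    ∃ C : ℝ, ∀ s : A →ₗ[ℂ] ℂ, IsNormalizedPositive 1 (fun a => ∃ b, a = star b * b) s →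
      ‖s v‖ ≤ C := by
  -- For self-adjoint `x`, positivity on `‖x‖ ± x` shows both that `s x` is real and that it lies
  -- between `-‖x‖` and `‖x‖`.
  have key : ∀ x : A, IsSelfAdjoint x → ∀ s : A →ₗ[ℂ] ℂ,
      IsNormalizedPositive 1 (fun a => ∃ b, a = star b * b) s → ‖s x‖ ≤ ‖x‖ := by
    intro x hx s hs
    have h1 := hs.2 _ (exists_star_mul_self_of_norm_le hx le_rfl)
    have h2 := hs.2 _ (exists_star_mul_self_of_norm_le hx.neg (norm_neg x).le)
    rw [map_add, map_smul, hs.1, Complex.le_def] at h1 h2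
    rw [map_neg] at h2
    simp at h1 h2
    have h3 : s x = ((s x).re : ℂ) := Complex.ext (by simp) (by simp [h1.2])
    rw [h3, Complex.norm_real, Real.norm_eq_abs, abs_le]
    constructor <;> linarith
  refine ⟨‖(realPart v : A)‖ + ‖(imaginaryPart v : A)‖, fun s hs => ?_⟩
  conv_lhs => rw [← realPart_add_I_smul_imaginaryPart v, map_add, map_smul]
  refine (norm_add_le _ _).trans (add_le_add (key _ (realPart v).2 s hs) ?_)
  rw [norm_smul, Complex.norm_I, one_mul]
  exact key _ (imaginaryPart v).2 s hs

end positivity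

/-! ### States on the minimal and maximal tensor products of operator systems. -/

namespace OperatorSystem

variable {A B : Type*} [CStarAlgebra A] [CStarAlgebra B] {S : OperatorSystem A}
  {T : OperatorSystem B}

theorem exists_selfAdjoint_add_I_smul (x : S.toSubmodule) :
    ∃ y z : S.toSubmodule, IsSelfAdjoint (y : A) ∧ IsSelfAdjoint (z : A) ∧
      x = y + Complex.I • z := by
  have h1 : (realPart (x : A) : A) ∈ S.toSubmodule := by
    rw [realPart_apply_coe, ← Complex.coe_smul]
    exact Submodule.smul_mem _ _ (Submodule.add_mem _ x.2 (S.star_mem' x.2))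
  have h2 : (imaginaryPart (x : A) : A) ∈ S.toSubmodule := by
    rw [imaginaryPart_apply_coe, ← Complex.coe_smul]
    exact Submodule.smul_mem _ _ (Submodule.smul_mem _ _
      (Submodule.sub_mem _ x.2 (S.star_mem' x.2)))
  exact ⟨⟨_, h1⟩, ⟨_, h2⟩, (realPart _).2, (imaginaryPart _).2,
    Subtype.ext (realPart_add_I_smul_imaginaryPart (x : A)).symm⟩

/-- Only the positivity of products of positive elements matters, so one argument serves both cones.
After Cartesian decomposition of the factors, it suffices to treat self-adjoint ones. -/
theorem exists_bound_of_isState {pos : S.toSubmodule ⊗[ℂ] T.toSubmodule → Prop}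
    (hpos : ∀ (x : S.toSubmodule) (y : T.toSubmodule), (∃ b, (x : A) = star b * b) →
      (∃ c, (y : B) = star c * c) → pos (x ⊗ₜ[ℂ] y)) (v : S.toSubmodule ⊗[ℂ] T.toSubmodule) :
    ∃ C : ℝ, ∀ s, IsState pos s → ‖s v‖ ≤ C := by
  have key : ∀ (x : S.toSubmodule) (y : T.toSubmodule), IsSelfAdjoint (x : A) →
      IsSelfAdjoint (y : B) → ∀ s, IsState pos s → ‖s (x ⊗ₜ[ℂ] y)‖ ≤ ‖(x : A)‖ * ‖(y : B)‖ := by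
    intro x y hx hy s hs
    have hS : ∀ z : S.toSubmodule, IsSelfAdjoint (z : A) →
        ∃ b, (((‖(z : A)‖ : ℂ) • S.unit + z : S.toSubmodule) : A) = star b * b :=
      fun z hz => exists_star_mul_self_of_norm_le hz le_rfl
    have hT : ∀ z : T.toSubmodule, IsSelfAdjoint (z : B) →
        ∃ b, (((‖(z : B)‖ : ℂ) • T.unit + z : T.toSubmodule) : B) = star b * b :=
      fun z hz => exists_star_mul_self_of_norm_le hz le_rfl
    have hx' : IsSelfAdjoint ((-x : S.toSubmodule) : A) := hx.neg
    have hy' : IsSelfAdjoint ((-y : T.toSubmodule) : B) := hy.neg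
    -- With `a = ‖x‖`, `b = ‖y‖`: `(a + x) ⊗ (b + y) + (a - x) ⊗ (b - y) = 2 (ab + x ⊗ y)`. Changing
    -- the sign of `y` gives `2 (ab - x ⊗ y)`.
    have h1 := add_nonneg (hs.2 _ (hpos _ _ (hS x hx) (hT y hy)))
      (hs.2 _ (hpos _ _ (hS (-x) hx') (hT (-y) hy')))
    have h2 := add_nonneg (hs.2 _ (hpos _ _ (hS x hx) (hT (-y) hy')))
      (hs.2 _ (hpos _ _ (hS (-x) hx') (hT y hy)))
    simp only [TensorProduct.add_tmul, TensorProduct.tmul_add, TensorProduct.neg_tmul,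
      TensorProduct.tmul_neg, ← TensorProduct.smul_tmul', TensorProduct.tmul_smul, map_add, map_neg,
      map_smul, hs.1, Submodule.coe_neg, norm_neg] at h1 h2
    rw [Complex.le_def] at h1 h2
    simp at h1 h2
    have h3 : s (x ⊗ₜ[ℂ] y) = ((s (x ⊗ₜ[ℂ] y)).re : ℂ) :=
      Complex.ext (by simp) (by simp; linarith [h1.2])
    rw [h3, Complex.norm_real, Real.norm_eq_abs, abs_le]
    constructor <;> linarith [h1.1, h2.1]
  induction v using TensorProduct.induction_on with
  | zero => exact ⟨0, fun s _ => by simp⟩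
  | add x y hx hy =>
    obtain ⟨C, hC⟩ := hx
    obtain ⟨D, hD⟩ := hy
    exact ⟨C + D, fun s hs => by
      rw [map_add]; exact (norm_add_le _ _).trans (add_le_add (hC s hs) (hD s hs))⟩
  | tmul x y =>
    obtain ⟨a, b, ha, hb, rfl⟩ := exists_selfAdjoint_add_I_smul x
    obtain ⟨c, d, hc, hd, rfl⟩ := exists_selfAdjoint_add_I_smul y
    refine ⟨‖(a : A)‖ * ‖(c : B)‖ + ‖(b : A)‖ * ‖(c : B)‖ + (‖(a : A)‖ * ‖(d : B)‖ +
      ‖(b : A)‖ * ‖(d : B)‖), fun s hs => ?_⟩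
    simp only [TensorProduct.add_tmul, TensorProduct.tmul_add, ← TensorProduct.smul_tmul',
      TensorProduct.tmul_smul, map_add, map_smul, smul_add]
    refine (norm_add_le _ _).trans (add_le_add ((norm_add_le _ _).trans (add_le_add ?_ ?_))
      ((norm_add_le _ _).trans (add_le_add ?_ ?_)))
    · exact key _ _ ha hc s hs
    · simpa using key _ _ hb hc s hs
    · simpa using key _ _ ha hd s hs
    · simpa using key _ _ hb hd s hs

theorem IsUCP.posSemidef_apply {p : ℕ} {φ : S.toSubmodule →ₗ[ℂ] Matrix (Fin p) (Fin p) ℂ}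
    (hφ : S.IsUCP φ) {x : S.toSubmodule} (hx : ∃ b, (x : A) = star b * b) : (φ x).PosSemidef := by
  obtain ⟨b, hb⟩ := hx
  have h := hφ.2 1 (Matrix.of fun _ _ => x) ⟨Matrix.of fun _ _ => b, by
    ext i j; simp [Matrix.mul_apply, hb]⟩
  exact h.submatrix fun i : Fin p => ((0 : Fin 1), i)

theorem tensorMap_tmul {p q : ℕ} (φ : S.toSubmodule →ₗ[ℂ] Matrix (Fin p) (Fin p) ℂ)
    (ψ : T.toSubmodule →ₗ[ℂ] Matrix (Fin q) (Fin q) ℂ) (x : S.toSubmodule) (y : T.toSubmodule) :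
    tensorMap φ ψ (x ⊗ₜ[ℂ] y) = Matrix.kronecker (φ x) (ψ y) := rfl

theorem minPos_tmul {x : S.toSubmodule} {y : T.toSubmodule} (hx : ∃ b, (x : A) = star b * b)
    (hy : ∃ c, (y : B) = star c * c) : MinPos S T (x ⊗ₜ[ℂ] y) := by
  intro p q φ ψ hφ hψ
  rw [tensorMap_tmul]
  exact (hφ.posSemidef_apply hx).kronecker (hψ.posSemidef_apply hy)

/-- The additional diagonal entry `1` is the source of the term `ε (1 ⊗ 1)` in `maxPos_tmul`. -/
theorem matrixPos_diagonal {x : S.toSubmodule} (hx : ∃ b, (x : A) = star b * b) :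
    S.MatrixPos (Matrix.diagonal ![x, S.unit]) := by
  obtain ⟨b, hb⟩ := hx
  refine ⟨Matrix.diagonal ![b, 1], ?_⟩
  rw [Matrix.star_eq_conjTranspose, Matrix.diagonal_conjTranspose, Matrix.diagonal_mul_diagonal]
  ext i j
  fin_cases i <;> fin_cases j <;> simp [hb, OperatorSystem.unit]

/-- Compressing `diag(x, 1) ⊗ diag(y, 1)` by the vector `e₀ ⊗ e₀ + √ε e₁ ⊗ e₁` leaves exactly `x ⊗ y
+ ε (1 ⊗ 1)`. -/
theorem maxPos_tmul {x : S.toSubmodule} {y : T.toSubmodule} (hx : ∃ b, (x : A) = star b * b)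
    (hy : ∃ c, (y : B) = star c * c) : MaxPos S T (x ⊗ₜ[ℂ] y) := by
  intro ε hε
  refine ⟨2, 2, _, _, fun i => if i = (0, 0) then 1 else if i = (1, 1) then (√ε : ℂ) else 0,
    matrixPos_diagonal hx, matrixPos_diagonal hy, ?_⟩
  have h : (√ε : ℂ) * √ε = ε := by exact_mod_cast Real.mul_self_sqrt hε.le
  simp [Fintype.sum_prod_type, Fin.sum_univ_two, h]

/-- Linear maps between operator systems that preserve positivity of matrices and the unit. -/
def IsUnitalCP (θ : S.toSubmodule →ₗ[ℂ] T.toSubmodule) : Prop :=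
  θ S.unit = T.unit ∧ ∀ (k : ℕ) (X : Matrix (Fin k) (Fin k) S.toSubmodule), S.MatrixPos X →
    T.MatrixPos (X.map θ)

/-! ### Functoriality of both cones under unital completely positive maps. -/

section rotate

variable {S' : OperatorSystem A} {θ : S.toSubmodule →ₗ[ℂ] S'.toSubmodule}

theorem IsUCP.comp (hθ : IsUnitalCP θ) {p : ℕ}
    {φ : S'.toSubmodule →ₗ[ℂ] Matrix (Fin p) (Fin p) ℂ} (hφ : S'.IsUCP φ) :
    S.IsUCP (φ ∘ₗ θ) :=
  ⟨by rw [LinearMap.comp_apply, hθ.1, hφ.1], fun k X hX => hφ.2 k _ (hθ.2 k X hX)⟩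

theorem MinPos.map (hθ : IsUnitalCP θ) {X : S.toSubmodule ⊗[ℂ] T.toSubmodule}
    (hX : MinPos S T X) : MinPos S' T (θ.rTensor T.toSubmodule X) := by
  intro p q φ ψ hφ hψ
  have h : tensorMap φ ψ ∘ₗ θ.rTensor T.toSubmodule = tensorMap (φ ∘ₗ θ) ψ :=
    TensorProduct.ext' fun x y => rfl
  rw [← LinearMap.comp_apply, h]
  exact hX p q _ ψ (hφ.comp hθ) hψ

theorem MaxPos.map (hθ : IsUnitalCP θ) {X : S.toSubmodule ⊗[ℂ] T.toSubmodule}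
    (hX : MaxPos S T X) : MaxPos S' T (θ.rTensor T.toSubmodule X) := by
  intro ε hε
  obtain ⟨p, q, P, Q, a, hP, hQ, h⟩ := hX ε hε
  refine ⟨p, q, P.map θ, Q, a, hθ.2 p P hP, hQ, ?_⟩
  have h1 := congrArg (θ.rTensor T.toSubmodule) h
  simpa only [map_add, map_smul, map_sum, LinearMap.rTensor_tmul, hθ.1, Matrix.map_apply] using h1

theorem IsState.comp_rTensor (hθ : IsUnitalCP θ)
    {pos : S.toSubmodule ⊗[ℂ] T.toSubmodule → Prop}
    {pos' : S'.toSubmodule ⊗[ℂ] T.toSubmodule → Prop}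
    (hpos : ∀ X, pos X → pos' (θ.rTensor T.toSubmodule X))
    {s : S'.toSubmodule ⊗[ℂ] T.toSubmodule →ₗ[ℂ] ℂ} (hs : IsState pos' s) :
    IsState pos (s ∘ₗ θ.rTensor T.toSubmodule) :=
  ⟨by rw [LinearMap.comp_apply, LinearMap.rTensor_tmul, hθ.1, hs.1],
    fun X hX => hs.2 _ (hpos X hX)⟩

end rotate

/-! ### Product states built from characters. -/

section characters

/-- The product of the restrictions of two characters. -/
noncomputable def prodCharacter (S : OperatorSystem A) (T : OperatorSystem B) (χ : A →⋆ₐ[ℂ] ℂ)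
    (η : B →⋆ₐ[ℂ] ℂ) : S.toSubmodule ⊗[ℂ] T.toSubmodule →ₗ[ℂ] ℂ :=
  LinearMap.mul' ℂ ℂ ∘ₗ TensorProduct.map (χ.toAlgHom.toLinearMap.domRestrict S.toSubmodule)
    (η.toAlgHom.toLinearMap.domRestrict T.toSubmodule)

variable (χ : A →⋆ₐ[ℂ] ℂ) (η : B →⋆ₐ[ℂ] ℂ)

theorem prodCharacter_tmul (x : S.toSubmodule) (y : T.toSubmodule) :
    prodCharacter S T χ η (x ⊗ₜ[ℂ] y) = χ x * η y := rfl

theorem MatrixPos.posSemidef_map {k : ℕ} {P : Matrix (Fin k) (Fin k) S.toSubmodule}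
    (hP : S.MatrixPos P) : (P.map fun x => χ x).PosSemidef := by
  obtain ⟨b, hb⟩ := hP
  have h : (P.map fun x => χ x) = Matrix.conjTranspose (b.map χ) * b.map χ := by
    ext i j
    have := congrArg χ (congrFun (congrFun hb i) j)
    simpa [Matrix.mul_apply, map_sum, map_star] using this
  rw [h]
  exact Matrix.posSemidef_conjTranspose_mul_self _

/-- A character as a map to `1 × 1` matrices. -/
noncomputable def characterMatrix (S : OperatorSystem A) :
    S.toSubmodule →ₗ[ℂ] Matrix (Fin 1) (Fin 1) ℂ where
  toFun x := Matrix.of fun _ _ => χ x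
  map_add' x y := by ext; simp
  map_smul' c x := by ext; simp

theorem isUCP_characterMatrix : S.IsUCP (characterMatrix χ S) := by
  refine ⟨?_, fun k X hX => ?_⟩
  · ext i j
    rw [Subsingleton.elim i j]
    simp [characterMatrix, OperatorSystem.unit]
  · exact (hX.posSemidef_map χ).submatrix fun a : Fin k × Fin 1 => a.1

/-- Characters are ucp maps into `M_1`, so the definition of the minimal cone applies with `p = q =
1`. -/
theorem isState_prodCharacter_minPos : IsState (MinPos S T) (prodCharacter S T χ η) := by
  refine ⟨by simp [prodCharacter_tmul, OperatorSystem.unit], fun X hX => ?_⟩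
  have h := hX 1 1 _ _ (isUCP_characterMatrix χ) (isUCP_characterMatrix η)
  have h1 : prodCharacter S T χ η X =
      tensorMap (characterMatrix χ S) (characterMatrix η T) X (0, 0) (0, 0) := by
    have h2 : prodCharacter S T χ η = Matrix.entryLinearMap ℂ ℂ ((0 : Fin 1), (0 : Fin 1)) (0, 0) ∘ₗ
        tensorMap (characterMatrix χ S) (characterMatrix η T) :=
      TensorProduct.ext' fun x y => rfl
    rw [h2]
    rfl
  rw [h1]
  exact h.diag_nonneg

/-- Applying the characters entrywise turns `P ⊗ Q` into a Kronecker product of positive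
semidefinite matrices, whose quadratic form at `a` is nonnegative. This gives positivity up to `ε`,
and then `ε → 0`. -/
theorem isState_prodCharacter_maxPos : IsState (MaxPos S T) (prodCharacter S T χ η) := by
  refine ⟨by simp [prodCharacter_tmul, OperatorSystem.unit], fun X hX => ?_⟩
  have key : ∀ ε : ℝ, 0 < ε → 0 ≤ prodCharacter S T χ η X + ε := by
    intro ε hε
    obtain ⟨p, q, P, Q, a, hP, hQ, h⟩ := hX ε hε
    have h1 := congrArg (prodCharacter S T χ η) h
    have h2 := ((hP.posSemidef_map χ).kronecker (hQ.posSemidef_map η)).dotProduct_mulVec_nonneg a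
    simp only [map_add, map_smul, map_sum, prodCharacter_tmul, OperatorSystem.unit, map_one,
      smul_eq_mul, mul_one] at h1
    rw [h1]
    convert h2 using 1
    simp only [dotProduct, Matrix.mulVec, Finset.mul_sum]
    refine Finset.sum_congr rfl fun i _ => Finset.sum_congr rfl fun j _ => ?_
    simp only [Pi.star_apply, Matrix.kroneckerMap_apply, Matrix.map_apply, RCLike.star_def]
    ring
  have h3 : Filter.Tendsto (fun ε : ℝ => prodCharacter S T χ η X + ε) (nhdsWithin 0 (Set.Ioi 0))
      (nhds (prodCharacter S T χ η X + (0 : ℝ))) :=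
    ((continuous_const.add Complex.continuous_ofReal).tendsto _).mono_left nhdsWithin_le_nhds
  rw [Complex.ofReal_zero, add_zero] at h3
  exact ge_of_tendsto h3 (Filter.eventually_of_mem self_mem_nhdsWithin fun ε hε => key ε hε)

end characters

end OperatorSystem

/-! ### The cases `qa` and `qmax`. -/

namespace unitarySystem

variable {n m : ℕ}

/-- Multiplication of the generators by a complex number of modulus one. -/
noncomputable def rotationHom {z : ℂ} (hz : ‖z‖ = 1) : BrownAlgebra n →⋆ₐ[ℂ] BrownAlgebra n :=
  BrownAlgebra.lift (z • Matrix.of BrownAlgebra.gen)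
    (smul_mem_unitary_of_norm_eq_one hz BrownAlgebra.gen_mem_unitary)

theorem rotationHom_gen {z : ℂ} (hz : ‖z‖ = 1) (i j : Fin n) :
    rotationHom hz (BrownAlgebra.gen i j) = z • BrownAlgebra.gen i j :=
  BrownAlgebra.lift_gen _ _ i j

theorem rotationHom_mem {z : ℂ} (hz : ‖z‖ = 1) {x : BrownAlgebra n}
    (hx : x ∈ (unitarySystem n).toSubmodule) :
    rotationHom hz x ∈ (unitarySystem n).toSubmodule := by
  change x ∈ Submodule.span ℂ _ at hx
  induction hx using Submodule.span_induction with
  | zero => simp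
  | add x y _ _ hx hy => rw [map_add]; exact Submodule.add_mem _ hx hy
  | smul c x _ hx => rw [map_smul]; exact Submodule.smul_mem _ _ hx
  | mem x hx =>
    have hg : ∀ i j, BrownAlgebra.gen i j ∈ (unitarySystem n).toSubmodule :=
      fun i j => (gen i j).2
    rcases hx with rfl | ⟨i, j, rfl | rfl⟩
    · rw [map_one]; exact (unitarySystem n).one_mem'
    · rw [Matrix.of_apply, rotationHom_gen]
      exact Submodule.smul_mem _ _ (hg i j)
    · rw [Matrix.of_apply, map_star, rotationHom_gen, star_smul]
      exact Submodule.smul_mem _ _ ((unitarySystem n).star_mem' (hg i j))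

/-- The restriction of `rotationHom` to the operator system. -/
noncomputable def rotation {z : ℂ} (hz : ‖z‖ = 1) :
    (unitarySystem n).toSubmodule →ₗ[ℂ] (unitarySystem n).toSubmodule :=
  (rotationHom hz).toAlgHom.toLinearMap.restrict fun _ => rotationHom_mem hz

theorem coe_rotation {z : ℂ} (hz : ‖z‖ = 1) (x : (unitarySystem n).toSubmodule) :
    (rotation hz x : BrownAlgebra n) = rotationHom hz x := rfl

theorem rotation_gen {z : ℂ} (hz : ‖z‖ = 1) (i j : Fin n) :
    rotation hz (gen i j) = z • gen i j :=
  Subtype.ext (rotationHom_gen hz i j)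

theorem isUnitalCP_rotation {z : ℂ} (hz : ‖z‖ = 1) :
    OperatorSystem.IsUnitalCP (rotation hz : _ →ₗ[ℂ] (unitarySystem n).toSubmodule) := by
  refine ⟨Subtype.ext (map_one (rotationHom hz)), fun k X ⟨b, hb⟩ => ⟨b.map (rotationHom hz), ?_⟩⟩
  ext i j
  have := congrArg (rotationHom hz) (congrFun (congrFun hb i) j)
  simpa [Matrix.mul_apply, map_sum, map_star, coe_rotation] using this

/-- The states of a tensor product of unitary systems have the properties required of a unit
ball. -/
theorem exists_norm_unitBall_of_isState
    {pos : (unitarySystem n).toSubmodule ⊗[ℂ] (unitarySystem m).toSubmodule → Prop}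
    (hpos : ∀ (x : (unitarySystem n).toSubmodule) (y : (unitarySystem m).toSubmodule),
      (∃ b, (x : BrownAlgebra n) = star b * b) →
      (∃ c, (y : BrownAlgebra m) = star c * c) → pos (x ⊗ₜ[ℂ] y))
    (hrot : ∀ (z : ℂ) (hz : ‖z‖ = 1) X, pos X → pos ((rotation hz).rTensor _ X))
    (hchar : ∀ χ η, OperatorSystem.IsState pos (OperatorSystem.prodCharacter _ _ χ η)) :
    ∃ ν : Seminorm ℂ (MatTensor n m), (∀ X, ν X = 0 → X = 0) ∧ {X | ν X ≤ 1} =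
      {X | ∃ s, OperatorSystem.IsState pos s ∧ X = ofCoords fun i j k l =>
        s (gen i j ⊗ₜ[ℂ] gen k l)} := by
  have hC := exists_norm_unitBall (C := stateCoords
    ((unitarySystem n).unit ⊗ₜ[ℂ] (unitarySystem m).unit) pos
    fun i j k l => gen i j ⊗ₜ[ℂ] gen k l) convex_stateCoords
    (isCompact_stateCoords (OperatorSystem.exists_bound_of_isState hpos)) (by
      -- The universal property supplies the automorphism `u i j ↦ z u i j`; precomposing a state
      -- with it in the first factor multiplies the coordinates by `z`.
      rintro z hz _ ⟨s, hs, rfl⟩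
      refine ⟨_, OperatorSystem.IsState.comp_rTensor (isUnitalCP_rotation hz) (hrot z hz) hs, ?_⟩
      ext i j k l
      simp [rotation_gen, ← TensorProduct.smul_tmul']) (by
      -- A scalar unitary matrix is the image of the generators under a character of the Brown
      -- algebra, so `x ⊗ y` comes from a product of two characters.
      rintro _ ⟨x, hx, y, hy, rfl⟩
      refine ⟨_, hchar (BrownAlgebra.lift x hx) (BrownAlgebra.lift y hy), ?_⟩
      ext i j k l
      rw [OperatorSystem.prodCharacter_tmul]
      exact (congrArg₂ _ (BrownAlgebra.lift_gen x hx i j) (BrownAlgebra.lift_gen y hy k l)).symm)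
  obtain ⟨ν, h0, hν⟩ := hC
  refine ⟨ν, h0, hν.trans ?_⟩
  ext X
  constructor
  · rintro ⟨_, ⟨s, hs, rfl⟩, rfl⟩
    exact ⟨s, hs, rfl⟩
  · rintro ⟨s, hs, rfl⟩
    exact ⟨_, ⟨s, hs, rfl⟩, rfl⟩

theorem exists_norm_unitBall_Bqa : ∃ ν : Seminorm ℂ (MatTensor n m),
    (∀ X, ν X = 0 → X = 0) ∧ {X | ν X ≤ 1} = Bqa n m :=
  exists_norm_unitBall_of_isState (fun _ _ => OperatorSystem.minPos_tmul)
    (fun _ hz _ hX => hX.map (isUnitalCP_rotation hz))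
    OperatorSystem.isState_prodCharacter_minPos

theorem exists_norm_unitBall_Bqmax : ∃ ν : Seminorm ℂ (MatTensor n m),
    (∀ X, ν X = 0 → X = 0) ∧ {X | ν X ≤ 1} = Bqmax n m :=
  exists_norm_unitBall_of_isState (fun _ _ => OperatorSystem.maxPos_tmul)
    (fun _ hz _ hX => hX.map (isUnitalCP_rotation hz))
    OperatorSystem.isState_prodCharacter_maxPos

end unitarySystem

/-! ### Images of unitary matrices and of their entries under homomorphisms. -/

section entries

variable {n m : ℕ} {A B : Type*} [CStarAlgebra A] [CStarAlgebra B]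

theorem map_mem_unitary (π : A →⋆ₐ[ℂ] B) {U : Matrix (Fin n) (Fin n) A}
    (hU : U ∈ unitary (Matrix (Fin n) (Fin n) A)) :
    U.map π ∈ unitary (Matrix (Fin n) (Fin n) B) := by
  have h : star (U.map π) = (star U).map π := by
    ext i j; simp [Matrix.star_apply, map_star]
  have h1 : ∀ X : Matrix (Fin n) (Fin n) A, X.map π = (π : A →+* B).mapMatrix X := fun _ => rfl
  rw [Unitary.mem_iff, h, h1, h1, ← map_mul, ← map_mul, hU.1, hU.2, map_one]
  exact ⟨rfl, rfl⟩

theorem entrySet_map (π : A →⋆ₐ[ℂ] B) (U : Matrix (Fin n) (Fin n) A) :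
    entrySet (U.map π) = π '' entrySet U := by
  ext x
  constructor
  · rintro (rfl | ⟨i, j, rfl | rfl⟩)
    · exact ⟨1, Or.inl rfl, map_one π⟩
    · exact ⟨_, Or.inr ⟨i, j, Or.inl rfl⟩, rfl⟩
    · exact ⟨_, Or.inr ⟨i, j, Or.inr rfl⟩, map_star π _⟩
  · rintro ⟨x, rfl | ⟨i, j, rfl | rfl⟩, rfl⟩
    · exact Or.inl (map_one π)
    · exact Or.inr ⟨i, j, Or.inl rfl⟩
    · exact Or.inr ⟨i, j, Or.inr (map_star π _)⟩

theorem exists_mem_entrySet_smul {z : ℂ} {U : Matrix (Fin n) (Fin n) A} {x : A}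
    (hx : x ∈ entrySet (z • U)) : ∃ c : ℂ, ∃ y ∈ entrySet U, x = c • y := by
  rcases hx with rfl | ⟨i, j, rfl | rfl⟩
  · exact ⟨1, 1, Or.inl rfl, (one_smul _ _).symm⟩
  · exact ⟨z, _, Or.inr ⟨i, j, Or.inl rfl⟩, rfl⟩
  · exact ⟨star z, _, Or.inr ⟨i, j, Or.inr rfl⟩, star_smul _ _⟩

end entries

/-! ### C⋆-algebraic models for `loc` and `qc`, and their products. -/

/-- A commuting pair of unitary matrices over a C⋆-algebra, with a state. If `p` holds, all the
entries and their adjoints commute with each other. -/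
structure UnitaryModel (n m : ℕ) (p : Prop) : Type (u + 1) where
  A : Type u
  [inst : CStarAlgebra A]
  U : Matrix (Fin n) (Fin n) A
  V : Matrix (Fin m) (Fin m) A
  s : A →ₗ[ℂ] ℂ
  hU : U ∈ unitary (Matrix (Fin n) (Fin n) A)
  hV : V ∈ unitary (Matrix (Fin m) (Fin m) A)
  hs : IsNormalizedPositive 1 (fun a => ∃ b, a = star b * b) s
  comm : ∀ x ∈ entrySet U, ∀ y ∈ entrySet V, x * y = y * x
  abelian : p → ∀ x ∈ entrySet U ∪ entrySet V, ∀ y ∈ entrySet U ∪ entrySet V, x * y = y * x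

namespace UnitaryModel

attribute [instance] UnitaryModel.inst

variable {n m : ℕ} {p : Prop}

/-- The correlations of a model. -/
noncomputable def coords (M : UnitaryModel.{u} n m p) : Coords n m :=
  fun i j k l => M.s (M.U i j * M.V k l)

/-- A normalized functional cannot live on the zero algebra. Nontriviality gives the unit of every
factor norm one, which the unital structure on the ℓ^∞-product uses. -/
theorem nontrivial (M : UnitaryModel.{u} n m p) : Nontrivial M.A := by
  refine ⟨0, 1, fun h => ?_⟩
  have := M.hs.1
  rw [← h, map_zero] at this
  exact zero_ne_one this

/-- The model with the first unitary multiplied by a number of modulus one. -/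
noncomputable def rotate (M : UnitaryModel.{u} n m p) {z : ℂ} (hz : ‖z‖ = 1) :
    UnitaryModel.{u} n m p :=
  { M with
    U := z • M.U
    hU := smul_mem_unitary_of_norm_eq_one hz M.hU
    comm := by
      intro x hx y hy
      obtain ⟨c, x', hx', rfl⟩ := exists_mem_entrySet_smul hx
      rw [smul_mul_assoc, mul_smul_comm, M.comm x' hx' y hy]
    abelian := by
      intro hp
      have key : ∀ x ∈ entrySet (z • M.U) ∪ entrySet M.V, ∃ c : ℂ,
          ∃ y ∈ entrySet M.U ∪ entrySet M.V, x = c • y := by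
        rintro x (hx | hx)
        · obtain ⟨c, y, hy, rfl⟩ := exists_mem_entrySet_smul hx
          exact ⟨c, y, Or.inl hy, rfl⟩
        · exact ⟨1, x, Or.inr hx, (one_smul _ _).symm⟩
      intro x hx y hy
      obtain ⟨c, x', hx', rfl⟩ := key x hx
      obtain ⟨d, y', hy', rfl⟩ := key y hy
      rw [smul_mul_smul_comm, smul_mul_smul_comm, M.abelian hp x' hx' y' hy', mul_comm c] }

theorem coords_rotate (M : UnitaryModel.{u} n m p) {z : ℂ} (hz : ‖z‖ = 1) :
    (M.rotate hz).coords = z • M.coords := by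
  ext i j k l
  change M.s ((z • M.U) i j * M.V k l) = z * M.s (M.U i j * M.V k l)
  rw [Matrix.smul_apply, smul_mul_assoc, map_smul, smul_eq_mul]

section ofScalars

/-- The model of a pair of scalar unitary matrices. -/
noncomputable def ofScalars {x : Matrix (Fin n) (Fin n) ℂ}
    (hx : x ∈ unitary (Matrix (Fin n) (Fin n) ℂ))
    {y : Matrix (Fin m) (Fin m) ℂ} (hy : y ∈ unitary (Matrix (Fin m) (Fin m) ℂ)) :
    UnitaryModel.{u} n m p where
  -- This is a copy of `ℂ` in universe `u`.
  A := PUnit.{u + 1} → ℂ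
  U := x.map (StarAlgHom.ofId ℂ (PUnit.{u + 1} → ℂ))
  V := y.map (StarAlgHom.ofId ℂ (PUnit.{u + 1} → ℂ))
  s := LinearMap.proj PUnit.unit
  hU := map_mem_unitary _ hx
  hV := map_mem_unitary _ hy
  hs := ⟨rfl, by
    rintro _ ⟨b, rfl⟩
    exact star_mul_self_nonneg (b PUnit.unit)⟩
  comm _ _ _ _ := mul_comm _ _
  abelian _ _ _ _ _ := mul_comm _ _

theorem coords_ofScalars {x : Matrix (Fin n) (Fin n) ℂ}
    (hx : x ∈ unitary (Matrix (Fin n) (Fin n) ℂ)) {y : Matrix (Fin m) (Fin m) ℂ}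
    (hy : y ∈ unitary (Matrix (Fin m) (Fin m) ℂ)) :
    (ofScalars hx hy : UnitaryModel.{u} n m p).coords = prodCoords x y := rfl

end ofScalars

section product

variable {ι : Type u} (M : ι → UnitaryModel.{u} n m p)

instance (i : ι) : Nontrivial (M i).A := (M i).nontrivial

/-- The bounded families in the product of the algebras of a family of models. -/
abbrev ProdAlgebra : Type u := lp (fun i => (M i).A) ∞

noncomputable instance : CStarAlgebra (ProdAlgebra M) where

/-- The family of the entries of unitary matrices. -/
def prodMatrix {k : ℕ} (W : ∀ i, Matrix (Fin k) (Fin k) (M i).A)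
    (hW : ∀ i, W i ∈ unitary (Matrix (Fin k) (Fin k) (M i).A)) :
    Matrix (Fin k) (Fin k) (ProdAlgebra M) :=
  Matrix.of fun a b => ⟨fun i => W i a b,
    memℓp_infty ⟨1, by rintro _ ⟨i, rfl⟩; exact BrownAlgebra.norm_entry_le (hW i) a b⟩⟩

variable {M} {k : ℕ} {W : ∀ i, Matrix (Fin k) (Fin k) (M i).A}
  {hW : ∀ i, W i ∈ unitary (Matrix (Fin k) (Fin k) (M i).A)}

theorem prodMatrix_mem_unitary :
    prodMatrix M W hW ∈ unitary (Matrix (Fin k) (Fin k) (ProdAlgebra M)) := by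
  rw [Unitary.mem_iff]
  constructor
  · ext a b i
    have h := congrFun (congrFun (hW i).1 a) b
    rw [Matrix.mul_apply] at h ⊢
    rw [lp.coeFn_sum, Finset.sum_apply]
    refine Eq.trans h ?_
    by_cases hab : a = b
    · subst hab; simp
    · simp [hab]
  · ext a b i
    have h := congrFun (congrFun (hW i).2 a) b
    rw [Matrix.mul_apply] at h ⊢
    rw [lp.coeFn_sum, Finset.sum_apply]
    refine Eq.trans h ?_
    by_cases hab : a = b
    · subst hab; simp
    · simp [hab]

theorem apply_mem_entrySet {x : ProdAlgebra M} (hx : x ∈ entrySet (prodMatrix M W hW)) (i : ι) :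
    x i ∈ entrySet (W i) := by
  rcases hx with rfl | ⟨a, b, rfl | rfl⟩
  · exact Or.inl rfl
  · exact Or.inr ⟨a, b, Or.inl rfl⟩
  · exact Or.inr ⟨a, b, Or.inr rfl⟩

/-- The product of a family of models. -/
noncomputable def prod (M : ι → UnitaryModel.{u} n m p) (s : ProdAlgebra M →ₗ[ℂ] ℂ)
    (hs : IsNormalizedPositive 1 (fun a => ∃ b, a = star b * b) s) : UnitaryModel.{u} n m p where
  A := ProdAlgebra M
  U := prodMatrix M _ fun i => (M i).hU
  V := prodMatrix M _ fun i => (M i).hV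
  s := s
  hU := prodMatrix_mem_unitary
  hV := prodMatrix_mem_unitary
  hs := hs
  comm x hx y hy := by
    ext i
    exact (M i).comm _ (apply_mem_entrySet hx i) _ (apply_mem_entrySet hy i)
  abelian hp x hx y hy := by
    ext i
    exact (M i).abelian hp _
      (hx.imp (fun h => apply_mem_entrySet h i) fun h => apply_mem_entrySet h i) _
      (hy.imp (fun h => apply_mem_entrySet h i) fun h => apply_mem_entrySet h i)

/-- The state of a factor, as a functional on the product. -/
noncomputable def factorState (M : ι → UnitaryModel.{u} n m p) (i : ι) : ProdAlgebra M →ₗ[ℂ] ℂ where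
  toFun x := (M i).s (x i)
  map_add' x y := by rw [lp.coeFn_add, Pi.add_apply, map_add]
  map_smul' c x := by rw [lp.coeFn_smul, Pi.smul_apply, map_smul, RingHom.id_apply]

theorem isNormalizedPositive_factorState (i : ι) :
    IsNormalizedPositive 1 (fun a => ∃ b, a = star b * b) (factorState M i) :=
  ⟨(M i).hs.1, by rintro _ ⟨b, rfl⟩; exact (M i).hs.2 _ ⟨b i, rfl⟩⟩

end product

variable (n m p) in
/-- The correlations of all models are the values of the states of a single C⋆-algebra. -/
theorem exists_range_coords_eq_stateCoords :
    ∃ (A : Type u) (_ : CStarAlgebra A) (g : Fin n → Fin n → Fin m → Fin m → A),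
      Set.range (coords : UnitaryModel.{u} n m p → Coords n m) =
        stateCoords (1 : A) (fun a => ∃ b, a = star b * b) g := by
  let S := Set.range (coords : UnitaryModel.{u} n m p → Coords n m)
  -- Choosing one model per attained correlation indexes the product by a type in universe `u`,
  -- although the models themselves do not form one. The state of each chosen factor recovers its
  -- correlation, and any state of the product defines a new model.
  let M : ULift.{u} S → UnitaryModel.{u} n m p := fun x => x.down.2.choose
  have hM : ∀ x : ULift.{u} S, (M x).coords = x.down.1 := fun x => x.down.2.choose_spec
  refine ⟨ProdAlgebra M, inferInstance, fun i j k l => prodMatrix M _ (fun i => (M i).hU) i j *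
    prodMatrix M _ (fun i => (M i).hV) k l, ?_⟩
  ext x
  constructor
  · intro hx
    exact ⟨factorState M ⟨x, hx⟩, isNormalizedPositive_factorState _, (hM ⟨x, hx⟩).symm⟩
  · rintro ⟨s, hs, rfl⟩
    exact ⟨prod M s hs, rfl⟩

variable (n m p) in
theorem exists_norm_unitBall_range_coords : ∃ ν : Seminorm ℂ (MatTensor n m),
    (∀ X, ν X = 0 → X = 0) ∧ {X | ν X ≤ 1} =
      ofCoords '' Set.range (coords : UnitaryModel.{u} n m p → Coords n m) := by
  obtain ⟨A, _, g, hg⟩ := exists_range_coords_eq_stateCoords.{u} n m p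
  refine exists_norm_unitBall ?_ ?_ ?_ ?_
  · rw [hg]; exact convex_stateCoords
  · rw [hg]; exact isCompact_stateCoords exists_bound_of_normalizedPositive
  · rintro z hz _ ⟨M, rfl⟩
    exact ⟨M.rotate hz, M.coords_rotate hz⟩
  · rintro _ ⟨x, hx, y, hy, rfl⟩
    exact ⟨ofScalars hx hy, coords_ofScalars hx hy⟩

end UnitaryModel

/-! ### Passage between abstract states and unit vectors. -/

section GNS

variable {A : Type u} [CStarAlgebra A]

/-- The Gelfand–Naimark–Segal construction. -/
theorem exists_representation {s : A →ₗ[ℂ] ℂ}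
    (hs : IsNormalizedPositive 1 (fun a => ∃ b, a = star b * b) s) :
    ∃ (H : Type u) (_ : NormedAddCommGroup H) (_ : InnerProductSpace ℂ H) (_ : CompleteSpace H)
      (π : A →⋆ₐ[ℂ] (H →L[ℂ] H)) (ψ : H), ‖ψ‖ = 1 ∧ ∀ a, inner ℂ ψ (π a ψ) = s a := by
  let _ : PartialOrder A := CStarAlgebra.spectralOrder A
  have _ : StarOrderedRing A := CStarAlgebra.spectralOrderedRing A
  let f : A →ₚ[ℂ] ℂ := PositiveLinearMap.mk₀ s fun a ha =>
    hs.2 a (CStarAlgebra.nonneg_iff_eq_star_mul_self.1 ha)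
  have hf : ∀ a, f a = s a := fun _ => rfl
  let ψ : f.GNS := ((f.toPreGNS 1 : f.PreGNS) : f.GNS)
  have key : ∀ a, inner ℂ ψ (f.gnsStarAlgHom a ψ) = s a := by
    intro a
    change inner ℂ ψ (f.gnsNonUnitalStarAlgHom a ψ) = s a
    rw [PositiveLinearMap.gnsNonUnitalStarAlgHom_apply_coe, UniformSpace.Completion.inner_coe,
      PositiveLinearMap.preGNS_inner_def]
    simp [hf]
  refine ⟨f.GNS, inferInstance, inferInstance, inferInstance, f.gnsStarAlgHom, ψ, ?_, key⟩
  have h1 := key 1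
  rw [map_one, one_apply_eq_self, hs.1, inner_self_eq_norm_sq_to_K] at h1
  have h2 : ‖ψ‖ ^ 2 = 1 := by
    have := congrArg Complex.re h1
    norm_cast at this
  nlinarith [norm_nonneg ψ]

end GNS

section vectorStates

variable {H : Type*} [NormedAddCommGroup H] [InnerProductSpace ℂ H] [CompleteSpace H]

/-- The functional `T ↦ ⟨T ψ, ψ⟩`. -/
noncomputable def vectorFunctional (ψ : H) : (H →L[ℂ] H) →ₗ[ℂ] ℂ where
  toFun T := inner ℂ ψ (T ψ)
  map_add' S T := by simp
  map_smul' c T := by simp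

theorem isNormalizedPositive_vectorFunctional {ψ : H} (hψ : ‖ψ‖ = 1) :
    IsNormalizedPositive 1 (fun a => ∃ b, a = star b * b) (vectorFunctional ψ) := by
  constructor
  · change inner ℂ ψ ψ = 1
    rw [inner_self_eq_norm_sq_to_K, hψ]
    simp
  · rintro _ ⟨b, rfl⟩
    change 0 ≤ inner ℂ ψ ((star b) (b ψ))
    rw [ContinuousLinearMap.star_eq_adjoint, ContinuousLinearMap.adjoint_inner_right]
    rw [inner_self_eq_norm_sq_to_K]
    simp

end vectorStates

/-! ### Commutativity of the generated C⋆-algebra. -/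

section commutative

variable {n m : ℕ} {A : Type*} [CStarAlgebra A]

theorem star_mem_entrySet {U : Matrix (Fin n) (Fin n) A} {x : A} (hx : x ∈ entrySet U) :
    star x ∈ entrySet U := by
  rcases hx with rfl | ⟨i, j, rfl | rfl⟩
  · exact Or.inl (star_one A)
  · exact Or.inr ⟨i, j, Or.inr rfl⟩
  · exact Or.inr ⟨i, j, Or.inl (star_star _)⟩

/-- The generating set is closed under adjoints, so commuting generators already give a commutative
`*`-algebra, and commutativity passes to the closure. -/
theorem mul_comm_of_mem_topologicalClosure_adjoin {U : Matrix (Fin n) (Fin n) A}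
    {V : Matrix (Fin m) (Fin m) A}
    (h : ∀ x ∈ entrySet U ∪ entrySet V, ∀ y ∈ entrySet U ∪ entrySet V, x * y = y * x) :
    ∀ x ∈ (StarAlgebra.adjoin ℂ (entrySet U ∪ entrySet V)).topologicalClosure,
      ∀ y ∈ (StarAlgebra.adjoin ℂ (entrySet U ∪ entrySet V)).topologicalClosure,
        x * y = y * x := by
  have h1 := StarAlgebra.isMulCommutative_adjoin ℂ h fun x hx y hy =>
    h x hx _ (hy.imp star_mem_entrySet star_mem_entrySet)
  intro x hx y hy
  let _ := StarSubalgebra.commRingTopologicalClosure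
    (StarAlgebra.adjoin ℂ (entrySet U ∪ entrySet V)) fun x y => h1.is_comm.comm x y
  exact congrArg Subtype.val (mul_comm
    (⟨x, hx⟩ : (StarAlgebra.adjoin ℂ (entrySet U ∪ entrySet V)).topologicalClosure) ⟨y, hy⟩)

theorem subset_topologicalClosure_adjoin (s : Set A) :
    s ⊆ (StarAlgebra.adjoin ℂ s).topologicalClosure :=
  (StarAlgebra.subset_adjoin ℂ s).trans (StarSubalgebra.le_topologicalClosure _)

end commutative

/-! ### Models describe exactly `B_qc` and `B_loc`. -/

namespace UnitaryModel

variable {n m : ℕ} {p : Prop}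

/-- A model of vector state type. -/
noncomputable def ofVector {H : Type u} [NormedAddCommGroup H] [InnerProductSpace ℂ H]
    [CompleteSpace H] {U : Matrix (Fin n) (Fin n) (H →L[ℂ] H)}
    {V : Matrix (Fin m) (Fin m) (H →L[ℂ] H)} {ψ : H}
    (hU : U ∈ unitary (Matrix (Fin n) (Fin n) (H →L[ℂ] H)))
    (hV : V ∈ unitary (Matrix (Fin m) (Fin m) (H →L[ℂ] H))) (hψ : ‖ψ‖ = 1)
    (comm : ∀ x ∈ entrySet U, ∀ y ∈ entrySet V, x * y = y * x)
    (abelian : p → ∀ x ∈ entrySet U ∪ entrySet V, ∀ y ∈ entrySet U ∪ entrySet V, x * y = y * x) :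
    UnitaryModel.{u} n m p where
  A := H →L[ℂ] H
  U := U
  V := V
  s := vectorFunctional ψ
  hU := hU
  hV := hV
  hs := isNormalizedPositive_vectorFunctional hψ
  comm := comm
  abelian := abelian

/-- The GNS representation preserves unitarity and all commutation relations because it is a
`*`-homomorphism, and it turns the state into a vector state. -/
theorem exists_vector (M : UnitaryModel.{u} n m p) :
    ∃ (H : Type u) (_ : NormedAddCommGroup H) (_ : InnerProductSpace ℂ H) (_ : CompleteSpace H)
      (U : Matrix (Fin n) (Fin n) (H →L[ℂ] H)) (V : Matrix (Fin m) (Fin m) (H →L[ℂ] H)) (ψ : H),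
      U ∈ unitary (Matrix (Fin n) (Fin n) (H →L[ℂ] H)) ∧
      V ∈ unitary (Matrix (Fin m) (Fin m) (H →L[ℂ] H)) ∧ ‖ψ‖ = 1 ∧
      (∀ x ∈ entrySet U, ∀ y ∈ entrySet V, x * y = y * x) ∧
      (p → ∀ x ∈ entrySet U ∪ entrySet V, ∀ y ∈ entrySet U ∪ entrySet V, x * y = y * x) ∧
      M.coords = fun i j k l => inner ℂ ψ ((U i j * V k l) ψ) := by
  obtain ⟨H, h1, h2, h3, π, ψ, hψ, hπ⟩ := exists_representation M.hs
  refine ⟨H, h1, h2, h3, M.U.map π, M.V.map π, ψ, map_mem_unitary π M.hU, map_mem_unitary π M.hV,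
    hψ, ?_, fun hp => ?_, ?_⟩
  · rw [entrySet_map, entrySet_map]
    rintro _ ⟨x, hx, rfl⟩ _ ⟨y, hy, rfl⟩
    rw [← map_mul, ← map_mul, M.comm x hx y hy]
  · rw [entrySet_map, entrySet_map, ← Set.image_union]
    rintro _ ⟨x, hx, rfl⟩ _ ⟨y, hy, rfl⟩
    rw [← map_mul, ← map_mul, M.abelian hp x hx y hy]
  · ext i j k l
    rw [Matrix.map_apply, Matrix.map_apply, ← map_mul, hπ]
    rfl

variable (n m)

/-- With `p = False` the field `abelian` is vacuous; with `p = True`, in the next theorem, it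
encodes the commutativity required in `Bloc`. -/
theorem image_range_coords_eq_Bqc :
    ofCoords '' Set.range (coords : UnitaryModel.{u} n m False → Coords n m) = Bqc.{u} n m := by
  ext X
  constructor
  · rintro ⟨_, ⟨M, rfl⟩, rfl⟩
    obtain ⟨H, h1, h2, h3, U, V, ψ, hU, hV, hψ, hc, -, h⟩ := M.exists_vector
    exact ⟨H, h1, h2, h3, U, V, ψ, hU, hV, hψ, hc, congrArg _ h⟩
  · rintro ⟨H, h1, h2, h3, U, V, ψ, hU, hV, hψ, hc, rfl⟩
    exact ⟨_, ⟨ofVector hU hV hψ hc False.elim, rfl⟩, rfl⟩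

theorem image_range_coords_eq_Bloc :
    ofCoords '' Set.range (coords : UnitaryModel.{u} n m True → Coords n m) = Bloc.{u} n m := by
  ext X
  constructor
  · rintro ⟨_, ⟨M, rfl⟩, rfl⟩
    obtain ⟨H, h1, h2, h3, U, V, ψ, hU, hV, hψ, hc, ha, h⟩ := M.exists_vector
    exact ⟨H, h1, h2, h3, U, V, ψ, hU, hV, hψ, hc,
      mul_comm_of_mem_topologicalClosure_adjoin (ha trivial), congrArg _ h⟩
  · rintro ⟨H, h1, h2, h3, U, V, ψ, hU, hV, hψ, hc, ha, rfl⟩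
    exact ⟨_, ⟨ofVector hU hV hψ hc fun _ x hx y hy =>
      ha x (subset_topologicalClosure_adjoin _ hx) y (subset_topologicalClosure_adjoin _ hy),
      rfl⟩, rfl⟩

end UnitaryModel

/-! ### A Russo–Dye estimate: seminorms bounded on unitaries. -/

section russoDye

variable {A : Type*} [CStarAlgebra A]

/-- A seminorm that is bounded on the unitaries is bounded by the norm on the invertible
elements. -/
theorem Seminorm.le_mul_norm_of_isUnit {p : Seminorm ℂ A} {C : ℝ}
    (hp : ∀ u ∈ unitary A, p u ≤ C) {x : A} (hx : IsUnit x) : p x ≤ C * ‖x‖ := by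
  let _ : PartialOrder A := CStarAlgebra.spectralOrder A
  have _ : StarOrderedRing A := CStarAlgebra.spectralOrderedRing A
  -- Polar decomposition: `|x|` is invertible along with `x`, so `w = x |x|⁻¹` is unitary and `x = w
  -- |x|`.
  have habs : IsUnit (CFC.abs x) := by
    have h : IsUnit (CFC.abs x * CFC.abs x) := by
      rw [CFC.abs_mul_abs]; exact hx.star.mul hx
    exact ((Commute.refl _).isUnit_mul_iff.1 h).1
  have hsa : IsSelfAdjoint (CFC.abs x) := (CFC.abs_nonneg x).isSelfAdjoint
  obtain ⟨a, ha⟩ := habs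
  have hainv : star (↑a⁻¹ : A) = ↑a⁻¹ := by
    have h : star a = a := Units.ext (by rw [Units.coe_star, ha, hsa.star_eq])
    rw [← Units.coe_star, star_inv, h]
  have hw : x * ↑a⁻¹ ∈ unitary A := by
    have h1 : star (x * ↑a⁻¹) * (x * ↑a⁻¹) = 1 := by
      rw [star_mul, hainv, mul_assoc, ← mul_assoc (star x), ← CFC.abs_mul_abs, ← ha]
      simp [mul_assoc]
    have h2 : IsUnit (x * ↑a⁻¹) := hx.mul a⁻¹.isUnit
    rw [Unitary.mem_iff]
    refine ⟨h1, ?_⟩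
    obtain ⟨w, hw⟩ := h2
    rw [← hw] at h1 ⊢
    have h3 : star (w : A) = ↑w⁻¹ := by
      rw [← mul_one (star (w : A)), ← w.mul_inv, ← mul_assoc, h1, one_mul]
    rw [h3, Units.mul_inv]
  have hxw : x = (x * ↑a⁻¹) * CFC.abs x := by rw [← ha]; simp
  set w : A := x * ↑a⁻¹
  rcases eq_or_ne x 0 with h0 | h0
  · rw [h0]; simp
  have hnorm : ‖CFC.abs x‖ = ‖x‖ := CFC.norm_abs
  have hpos : 0 < ‖x‖ := norm_pos_iff.2 h0
  -- A self-adjoint contraction `b` is the mean of the unitary `v = b + i √(1 - b²)` and its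
  -- adjoint. Hence `x = (‖x‖ / 2) (w v + w v⋆)`, a multiple of a sum of two unitaries.
  let b : selfAdjoint A := ⟨(‖x‖⁻¹ : ℝ) • CFC.abs x, (IsSelfAdjoint.all _).smul hsa⟩
  have hb : ‖b‖ ≤ 1 := by
    change ‖(‖x‖⁻¹ : ℝ) • CFC.abs x‖ ≤ 1
    rw [norm_smul, hnorm, norm_inv, norm_norm, inv_mul_cancel₀ hpos.ne']
  let v := selfAdjoint.unitarySelfAddISMul b hb
  have h1 : CFC.abs x = ((‖x‖ / 2 : ℝ) : ℂ) • ((v : A) + (star v : unitary A)) := by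
    have h2 : (v : A) + (star v : unitary A) = (2 : ℝ) • (b : A) := by
      have h := congrArg Subtype.val (selfAdjoint.realPart_unitarySelfAddISMul b hb)
      rw [realPart_apply_coe] at h
      rw [← h, smul_smul]
      norm_num [v]
    rw [h2, Complex.coe_smul, smul_smul, smul_smul]
    have : ‖x‖ / 2 * 2 * ‖x‖⁻¹ = 1 := by field_simp
    rw [this, one_smul]
  have h2 : p x = ‖x‖ / 2 * p (w * v + w * (star v : unitary A)) := by
    conv_lhs => rw [hxw, h1, mul_smul_comm, map_smul_eq_mul, mul_add, Complex.norm_real,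
      Real.norm_of_nonneg (by positivity)]
  rw [h2]
  have h3 : p (w * v + w * (star v : unitary A)) ≤ C + C :=
    (map_add_le_add p _ _).trans (add_le_add (hp _ (mul_mem hw v.2)) (hp _ (mul_mem hw (star v).2)))
  nlinarith

open scoped Matrix.Norms.L2Operator in
/-- A seminorm that is bounded on the unitary matrices is bounded by the operator norm. -/
theorem Seminorm.le_mul_norm_of_unitary {n : ℕ} {p : Seminorm ℂ (Matrix (Fin n) (Fin n) ℂ)} {C : ℝ}
    (hp : ∀ u ∈ unitary (Matrix (Fin n) (Fin n) ℂ), p u ≤ C) (x : Matrix (Fin n) (Fin n) ℂ) :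
    p x ≤ C * ‖x‖ := by
  have hC : 0 ≤ C := (apply_nonneg p _).trans (hp 1 (one_mem _))
  refine le_of_forall_pos_le_add fun ε hε => ?_
  -- The spectrum of a matrix is finite, so `c - x` is invertible for some arbitrarily small `c`.
  -- The error is at most `2 * C * ‖c‖`, one `C * ‖c‖` from `p (c • 1)` and one from `‖c • 1 - x‖`;
  -- the `+ 1` in the radius allows `C = 0`.
  obtain ⟨c, hc, hcx⟩ : ∃ c : ℂ, c ∈ Metric.ball (0 : ℂ) (ε / (2 * C + 1)) ∧
      c ∉ spectrum ℂ x := by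
    have hinf : (Metric.ball (0 : ℂ) (ε / (2 * C + 1))).Infinite :=
      infinite_of_mem_nhds 0 (Metric.ball_mem_nhds 0 (by positivity))
    obtain ⟨c, hc, hcx⟩ := (hinf.sdiff (Matrix.finite_spectrum x)).nonempty
    exact ⟨c, hc, hcx⟩
  rw [mem_ball_zero_iff, lt_div_iff₀ (by positivity)] at hc
  have hu := spectrum.notMem_iff.1 hcx
  rw [Algebra.algebraMap_eq_smul_one] at hu
  have h1 := Seminorm.le_mul_norm_of_isUnit hp hu
  have h2 : ‖c • (1 : Matrix (Fin n) (Fin n) ℂ) - x‖ ≤ ‖c‖ + ‖x‖ := by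
    refine (norm_sub_le _ _).trans (add_le_add ?_ le_rfl)
    rw [norm_smul]
    exact mul_le_of_le_one_right (norm_nonneg c) BrownAlgebra.norm_one_le
  have h3 : p x ≤ p (c • (1 : Matrix (Fin n) (Fin n) ℂ)) + p (c • 1 - x) := by
    have := map_sub_le_add p (c • (1 : Matrix (Fin n) (Fin n) ℂ)) (c • 1 - x)
    rwa [sub_sub_cancel] at this
  have h4 : p (c • (1 : Matrix (Fin n) (Fin n) ℂ)) ≤ ‖c‖ * C := by
    rw [map_smul_eq_mul]
    exact mul_le_mul_of_nonneg_left (hp 1 (one_mem _)) (norm_nonneg c)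
  have h5 := mul_le_mul_of_nonneg_left h2 hC
  nlinarith [norm_nonneg c]

end russoDye

/-! ### Commutative models are controlled by scalar unitaries. -/

section commutative

variable {n m : ℕ}

theorem IsNormalizedPositive.im_eq_zero {A : Type*} [CStarAlgebra A] {s : A →ₗ[ℂ] ℂ}
    (hs : IsNormalizedPositive 1 (fun a => ∃ b, a = star b * b) s) {x : A}
    (hx : IsSelfAdjoint x) : (s x).im = 0 := by
  have h := (Complex.le_def.1 (hs.2 _ (exists_star_mul_self_of_norm_le hx le_rfl))).2
  rw [map_add, map_smul, hs.1] at h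
  simpa using h.symm

/-- By Gelfand theory, every spectral value of `c - Re a` is the value of a character, hence
nonnegative. So `c - Re a` is positive and `s` is nonnegative on it. This replaces writing `s` as an
integral over the characters. -/
theorem re_apply_le_of_forall_character {A : Type*} [CommCStarAlgebra A] {s : A →ₗ[ℂ] ℂ}
    (hs : IsNormalizedPositive 1 (fun a => ∃ b, a = star b * b) s) {a : A} {c : ℝ}
    (ha : ∀ χ : A →⋆ₐ[ℂ] ℂ, (χ a).re ≤ c) : (s a).re ≤ c := by
  let _ : PartialOrder A := CStarAlgebra.spectralOrder A
  have _ : StarOrderedRing A := CStarAlgebra.spectralOrderedRing A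
  -- This passage between `a` and its real part is needed twice, for the characters and for `s`.
  have hre : ∀ f : A →ₗ[ℂ] ℂ, (∀ x : A, IsSelfAdjoint x → (f x).im = 0) →
      (f (realPart a)).re = (f a).re := by
    intro f hf
    conv_rhs => rw [← realPart_add_I_smul_imaginaryPart a, map_add, map_smul]
    simp [hf _ (imaginaryPart a).2]
  have hsa : IsSelfAdjoint ((c : ℂ) • (1 : A) - realPart a) := by
    refine IsSelfAdjoint.sub ?_ (realPart a).2
    rw [Complex.coe_smul]
    exact (IsSelfAdjoint.all c).smul (IsSelfAdjoint.one A)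
  have h0 : 0 ≤ (c : ℂ) • (1 : A) - realPart a := by
    rw [StarOrderedRing.nonneg_iff_spectrum_nonneg (R := ℝ) _ hsa]
    intro r hr
    have hr' : (r : ℂ) ∈ spectrum ℂ ((c : ℂ) • (1 : A) - realPart a) :=
      (spectrum.algebraMap_mem_iff ℂ).2 hr
    obtain ⟨χ, hχ⟩ := WeakDual.CharacterSpace.mem_spectrum_iff_exists.1 hr'
    let χ' : A →⋆ₐ[ℂ] ℂ := StarAlgHomClass.toStarAlgHom χ
    have h1 : χ' ((c : ℂ) • (1 : A) - realPart a) = r := hχ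
    have h2 := hre χ'.toAlgHom.toLinearMap fun x hx => by
      have h : star (χ' x) = χ' x := by rw [← map_star, hx.star_eq]
      exact Complex.conj_eq_iff_im.1 h
    rw [map_sub, map_smul, map_one] at h1
    have h3 := congrArg Complex.re h1
    have h4 : (χ' (realPart a)).re = (χ' a).re := h2
    simp at h3
    linarith [ha χ']
  have h1 := (Complex.le_def.1 (hs.2 _ (CStarAlgebra.nonneg_iff_eq_star_mul_self.1 h0))).1
  rw [map_sub, map_smul, hs.1] at h1
  simp [hre s fun x hx => hs.im_eq_zero hx] at h1
  exact h1

theorem exists_coefficients (F : Coords n m →ₗ[ℂ] ℂ) :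
    ∃ c : Coords n m, ∀ x, F x = ∑ i, ∑ j, ∑ k, ∑ l, x i j k l * c i j k l := by
  refine ⟨fun i j k l => F (coordsEquiv n m (Matrix.single i j 1 ⊗ₜ[ℂ] Matrix.single k l 1)),
    fun x => ?_⟩
  conv_lhs => rw [← (coordsEquiv n m).apply_symm_apply x, coordsEquiv_symm_apply, ofCoords]
  simp only [map_sum, map_smul, smul_eq_mul]

/-- The value of `F` is that of `s` at a single element, a linear combination of the `U i j * V k
l`. A character evaluates this element to `F` at a product of two scalar unitaries, where the bound
is assumed. -/
theorem re_apply_le_of_comm {A : Type*} [CommCStarAlgebra A] {U : Matrix (Fin n) (Fin n) A}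
    {V : Matrix (Fin m) (Fin m) A} (hU : U ∈ unitary (Matrix (Fin n) (Fin n) A))
    (hV : V ∈ unitary (Matrix (Fin m) (Fin m) A)) {s : A →ₗ[ℂ] ℂ}
    (hs : IsNormalizedPositive 1 (fun a => ∃ b, a = star b * b) s) (F : Coords n m →ₗ[ℂ] ℂ) {c : ℝ}
    (hF : ∀ x ∈ unitaryProducts n m, (F x).re ≤ c) :
    (F fun i j k l => s (U i j * V k l)).re ≤ c := by
  obtain ⟨f, hf⟩ := exists_coefficients F
  have key : ∀ t : A →ₗ[ℂ] ℂ, F (fun i j k l => t (U i j * V k l)) =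
      t (∑ i, ∑ j, ∑ k, ∑ l, f i j k l • (U i j * V k l)) := by
    intro t
    rw [hf]
    simp only [map_sum, map_smul, smul_eq_mul, mul_comm]
  rw [key]
  refine re_apply_le_of_forall_character hs fun χ => ?_
  have h := key χ.toAlgHom.toLinearMap
  refine (congrArg Complex.re h).symm.trans_le
    (hF _ ⟨_, map_mem_unitary χ hU, _, map_mem_unitary χ hV, ?_⟩)
  ext i j k l
  exact (map_mul χ _ _).symm

/-- The algebra of the model need not be commutative, so everything is restricted to the closed
`*`-subalgebra generated by the entries. The unitary relations descend to it because the inclusion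
is injective. -/
theorem UnitaryModel.re_apply_coords_le (M : UnitaryModel.{u} n m True) (F : Coords n m →ₗ[ℂ] ℂ)
    {c : ℝ} (hF : ∀ x ∈ unitaryProducts n m, (F x).re ≤ c) : (F M.coords).re ≤ c := by
  let S := (StarAlgebra.adjoin ℂ (entrySet M.U ∪ entrySet M.V)).topologicalClosure
  have hcl : IsClosed (S : Set M.A) := StarSubalgebra.isClosed_topologicalClosure _
  have hcomm := mul_comm_of_mem_topologicalClosure_adjoin (M.abelian trivial)
  let _ : CommCStarAlgebra S :=
    { (inferInstance : CStarAlgebra S) with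
      mul_comm := fun x y => Subtype.ext (hcomm x x.2 y y.2) }
  have hsub := subset_topologicalClosure_adjoin (entrySet M.U ∪ entrySet M.V)
  let U : Matrix (Fin n) (Fin n) S :=
    Matrix.of fun i j => ⟨M.U i j, hsub (Or.inl (Or.inr ⟨i, j, Or.inl rfl⟩))⟩
  let V : Matrix (Fin m) (Fin m) S :=
    Matrix.of fun i j => ⟨M.V i j, hsub (Or.inr (Or.inr ⟨i, j, Or.inl rfl⟩))⟩
  have hunit : ∀ {k : ℕ} {W : Matrix (Fin k) (Fin k) S},
      W.map S.subtype ∈ unitary (Matrix (Fin k) (Fin k) M.A) →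
        W ∈ unitary (Matrix (Fin k) (Fin k) S) := by
    intro k W hW
    have h : star (W.map S.subtype) = (star W).map S.subtype := by
      ext i j; simp [Matrix.star_apply]
    have hmap : ∀ X : Matrix (Fin k) (Fin k) S, X.map S.subtype =
        (S.subtype : S →+* M.A).mapMatrix X := fun _ => rfl
    have hinj : Function.Injective
        ((S.subtype : S →+* M.A).mapMatrix : Matrix (Fin k) (Fin k) S →+* _) := by
      intro X Y hXY
      ext i j
      exact congrFun (congrFun hXY i) j
    rw [Unitary.mem_iff, h, hmap, hmap, ← map_mul, ← map_mul] at hW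
    exact ⟨hinj (hW.1.trans (map_one _).symm), hinj (hW.2.trans (map_one _).symm)⟩
  have hs : IsNormalizedPositive 1 (fun a => ∃ b, a = star b * b)
      (M.s ∘ₗ S.subtype.toAlgHom.toLinearMap) :=
    ⟨M.hs.1, by rintro _ ⟨b, rfl⟩; exact M.hs.2 _ ⟨b, rfl⟩⟩
  exact re_apply_le_of_comm (U := U) (V := V) (hunit M.hU) (hunit M.hV) hs F hF

end commutative

/-! ### The `loc` norm is the projective tensor norm. -/

section projective

variable {n m : ℕ}

theorem balanced_convexHull_unitaryProducts :
    Balanced ℂ (convexHull ℝ (unitaryProducts n m)) := by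
  refine (convex_convexHull ℝ _).balanced_of_circle fun z hz x hx => ?_
  have h : Convex ℝ {y : Coords n m | z • y ∈ convexHull ℝ (unitaryProducts n m)} :=
    (convex_convexHull ℝ _).linear_preimage
      ((LinearMap.lsmul ℂ (Coords n m) z).restrictScalars ℝ)
  exact convexHull_min (t := {y | z • y ∈ convexHull ℝ (unitaryProducts n m)})
    (fun y hy => subset_convexHull ℝ _ (smul_mem_unitaryProducts hz hy)) h hx

theorem absorbent_convexHull_unitaryProducts :
    Absorbent ℝ (convexHull ℝ (unitaryProducts n m)) :=
  absorbent_of_unitaryProducts_subset (convex_convexHull ℝ _) balanced_convexHull_unitaryProducts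
    (subset_convexHull ℝ _)

/-- Hahn–Banach: a functional separating the correlation from the gauge ball would be bounded on the
products of unitaries by a constant that it exceeds at the correlation. Working with the gauge ball,
closed by continuity of the gauge, avoids proving that the convex hull itself is closed. -/
theorem UnitaryModel.gauge_coords_le_one (M : UnitaryModel.{u} n m True) :
    gauge (convexHull ℝ (unitaryProducts n m)) M.coords ≤ 1 := by
  let g := gaugeSeminorm (balanced_convexHull_unitaryProducts (n := n) (m := m))
    (convex_convexHull ℝ _) absorbent_convexHull_unitaryProducts
  have hconv : ConvexOn ℝ Set.univ g := g.convexOn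
  -- Convex functions on a finite-dimensional space are continuous.
  have hcont : Continuous g := hconv.locallyLipschitz.continuous
  have hB : Convex ℝ {x | g x ≤ 1} := by simpa using hconv.convex_le 1
  have hBc : IsClosed {x | g x ≤ 1} := isClosed_le hcont continuous_const
  by_contra hM
  obtain ⟨F, c, hF, hc⟩ := RCLike.geometric_hahn_banach_closed_point (𝕜 := ℂ) hB hBc
    (x := M.coords) hM
  exact hc.not_ge (M.re_apply_coords_le F.toLinearMap fun x hx =>
    (hF x (gauge_le_one_of_mem (subset_convexHull ℝ _ hx))).le)

-- A convex combination of products of unitaries is already a representation; the factor `r` and the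
-- weights are absorbed into the first tensor factors.
open scoped Matrix.Norms.L2Operator in
theorem exists_representation_of_mem_convexHull {x : Coords n m}
    (hx : x ∈ convexHull ℝ (unitaryProducts n m)) {r : ℝ} (hr : 0 ≤ r) :
    ∃ (d : ℕ) (a : Fin d → Matrix (Fin n) (Fin n) ℂ) (b : Fin d → Matrix (Fin m) (Fin m) ℂ),
      ofCoords (r • x) = ∑ i, a i ⊗ₜ[ℂ] b i ∧ ∑ i, ‖a i‖ * ‖b i‖ ≤ r := by
  obtain ⟨ι, _, w, z, hw0, hw1, hz, rfl⟩ := mem_convexHull_iff_exists_fintype.1 hx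
  choose a ha b hb hab using hz
  -- An inequality rather than an equality, since for `k = 0` the unit matrix has norm zero.
  have hnorm : ∀ {k : ℕ} {u : Matrix (Fin k) (Fin k) ℂ},
      u ∈ unitary (Matrix (Fin k) (Fin k) ℂ) → ‖u‖ ≤ 1 := by
    intro k u hu
    have h := CStarRing.norm_star_mul_self (x := u)
    rw [(Unitary.mem_iff.1 hu).1] at h
    have h1 : ‖(1 : Matrix (Fin k) (Fin k) ℂ)‖ ≤ 1 := BrownAlgebra.norm_one_le
    nlinarith [norm_nonneg u]
  let e := (Fintype.equivFin ι).symm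
  refine ⟨Fintype.card ι, fun i => ((r * w (e i) : ℝ) : ℂ) • a (e i), fun i => b (e i), ?_, ?_⟩
  · rw [e.sum_comp fun i => (((r * w i : ℝ) : ℂ) • a i) ⊗ₜ[ℂ] b i, ← coordsEquiv_symm_apply,
      LinearEquiv.symm_apply_eq, map_sum, Finset.smul_sum]
    refine Finset.sum_congr rfl fun i _ => ?_
    rw [← TensorProduct.smul_tmul', map_smul, coordsEquiv_tmul, hab, Complex.coe_smul, smul_smul]
  · rw [e.sum_comp fun i => ‖((r * w i : ℝ) : ℂ) • a i‖ * ‖b i‖]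
    calc ∑ i, ‖((r * w i : ℝ) : ℂ) • a i‖ * ‖b i‖ ≤ ∑ i, r * w i := by
          refine Finset.sum_le_sum fun i _ => ?_
          have h := mul_nonneg hr (hw0 i)
          rw [norm_smul, Complex.norm_real, Real.norm_of_nonneg h, mul_assoc]
          exact mul_le_of_le_one_right h
            (mul_le_one₀ (hnorm (ha i)) (norm_nonneg _) (hnorm (hb i)))
      _ = r := by rw [← Finset.mul_sum, hw1, mul_one]

open scoped Matrix.Norms.L2Operator in
/-- A seminorm whose unit ball is `B_loc` is the projective tensor norm. -/
theorem eq_projectiveTensorNorm {ν : Seminorm ℂ (MatTensor n m)}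
    (hν : {X | ν X ≤ 1} = Bloc.{u} n m) (X : MatTensor n m) : ν X = projectiveTensorNorm X := by
  rw [← UnitaryModel.image_range_coords_eq_Bloc] at hν
  have hgauge : ∀ Y : MatTensor n m, ν Y ≤ 1 →
      gauge (convexHull ℝ (unitaryProducts n m)) (coordsEquiv n m Y) ≤ 1 := by
    intro Y hY
    have : Y ∈ {X | ν X ≤ 1} := hY
    rw [hν] at this
    obtain ⟨_, ⟨M, rfl⟩, rfl⟩ := this
    rw [← coordsEquiv_symm_apply, LinearEquiv.apply_symm_apply]
    exact M.gauge_coords_le_one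
  have hrep : ∀ r : ℝ, ν X < r →
      ∃ (d : ℕ) (a : Fin d → Matrix (Fin n) (Fin n) ℂ) (b : Fin d → Matrix (Fin m) (Fin m) ℂ),
        X = ∑ i, a i ⊗ₜ[ℂ] b i ∧ ∑ i, ‖a i‖ * ‖b i‖ ≤ r := by
    intro r hr
    -- The intermediate `t` is positive even if `ν X = 0`, so `X` can be normalized by it, and `t <
    -- r` gives the strict gauge inequality needed to place `X` in a dilate of the hull.
    obtain ⟨t, ht, htr⟩ := exists_between hr
    have ht0 : 0 < t := (apply_nonneg ν X).trans_lt ht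
    have h1 : ν (((t⁻¹ : ℝ) : ℂ) • X) ≤ 1 := by
      rw [map_smul_eq_mul, Complex.norm_real, Real.norm_of_nonneg (by positivity),
        inv_mul_le_iff₀ ht0, mul_one]
      exact ht.le
    have h2 := hgauge _ h1
    rw [map_smul, Complex.coe_smul, gauge_smul_of_nonneg (by positivity), smul_eq_mul,
      inv_mul_le_iff₀ ht0, mul_one] at h2
    obtain ⟨q, hq0, hqr, x, hx, hxX⟩ :=
      exists_lt_of_gauge_lt absorbent_convexHull_unitaryProducts (h2.trans_lt htr)
    obtain ⟨d, a, b, hab, hq⟩ := exists_representation_of_mem_convexHull hx hq0.le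
    refine ⟨d, a, b, ?_, hq.trans hqr.le⟩
    rw [← hab, ← coordsEquiv_symm_apply]
    exact ((coordsEquiv n m).symm_apply_eq.2 hxX).symm
  have htmul : ∀ (x : Matrix (Fin n) (Fin n) ℂ) (y : Matrix (Fin m) (Fin m) ℂ),
      ν (x ⊗ₜ[ℂ] y) ≤ ‖x‖ * ‖y‖ := by
    intro x y
    -- The Russo–Dye estimate is applied in `y` with constant `‖x‖`, whose hypothesis is the same
    -- estimate in `x` with constant `1`.
    refine Seminorm.le_mul_norm_of_unitary
      (p := ν.comp (TensorProduct.mk ℂ _ _ x)) (fun v hv => ?_) y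
    refine (Seminorm.le_mul_norm_of_unitary
      (p := ν.comp ((TensorProduct.mk ℂ _ _).flip v)) (C := 1) (fun u hu => ?_) x).trans_eq
        (one_mul _)
    change u ⊗ₜ[ℂ] v ∈ {X | ν X ≤ 1}
    rw [hν]
    exact ⟨_, ⟨UnitaryModel.ofScalars hu hv, UnitaryModel.coords_ofScalars hu hv⟩,
      ofCoords_prodCoords u v⟩
  refine le_antisymm (le_csInf ?_ ?_) (le_of_forall_gt_imp_ge_of_dense fun r hr => ?_)
  · obtain ⟨d, a, b, hab, -⟩ := hrep (ν X + 1) (lt_add_one _)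
    exact ⟨_, d, a, b, hab, rfl⟩
  · rintro _ ⟨d, a, b, rfl, rfl⟩
    exact (Finset.le_sum_of_subadditive ν (map_zero ν).le (map_add_le_add ν) _ _).trans
      (Finset.sum_le_sum fun i _ => htmul _ _)
  · obtain ⟨d, a, b, hab, h⟩ := hrep r hr
    refine le_trans (csInf_le ?_ ?_) h
    · refine ⟨0, ?_⟩
      rintro _ ⟨d, a, b, -, rfl⟩
      exact Finset.sum_nonneg fun i _ => by positivity
    · exact ⟨d, a, b, hab, rfl⟩

end projective

/-! ### Assembly of the four cases. -/

theorem mainTheorem4 (n m : ℕ) :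
    ∃ ν : CorrelationType → Seminorm ℂ (MatTensor n m),
      (∀ t, (∀ X, ν t X = 0 → X = 0) ∧ {X | ν t X ≤ 1} = correlationSet.{u} t n m) ∧
      ∀ X, ν CorrelationType.loc X = projectiveTensorNorm X := by
  have h : ∀ t, ∃ ν : Seminorm ℂ (MatTensor n m),
      (∀ X, ν X = 0 → X = 0) ∧ {X | ν X ≤ 1} = correlationSet.{u} t n m
    | .loc => by
      rw [correlationSet, ← UnitaryModel.image_range_coords_eq_Bloc]
      exact UnitaryModel.exists_norm_unitBall_range_coords n m True
    | .qa => unitarySystem.exists_norm_unitBall_Bqa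
    | .qc => by
      rw [correlationSet, ← UnitaryModel.image_range_coords_eq_Bqc]
      exact UnitaryModel.exists_norm_unitBall_range_coords n m False
    | .qmax => unitarySystem.exists_norm_unitBall_Bqmax
  choose ν hν using h
  exact ⟨ν, hν, eq_projectiveTensorNorm (hν .loc).2⟩
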